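/- Let $M$ be a smooth ($C^\infty$, Hausdorff, finite-dimensional) manifold, $P$ a smooth bivector field and $\psi$ a smooth differential $3$-form on $M$, and let $V^\bullet(M)=\Gamma(\bigwedge^\bullet TM)$ be the algebra of multivector fields. Conventions: $\langle\eta,P^\sharp\xi\rangle=P(\xi,\eta)$ (that is, $P^\sharp\xi=i_\xi P$), $i_{X\wedge Y}=i_X\circ i_Y$ on forms (so $(i_{X\wedge Y}\psi)(Z)=\psi(Y,X,Z)$), and $[\cdot,\cdot]_{SN}$ is the Schouten–Nijenhuis bracket, normalized by $[X,f]_{SN}=X f$, $[X,Y]_{SN}=[X,Y]$ for vector fields $X,Y$ and functions $f$, and by $[u,v\wedge w]_{SN}=[u,v]_{SN}\wedge w+(-1)^{(|u|-1)|v|}v\wedge[u,w]_{SN}$, $[u,v]_{SN}=-(-1)^{(|u|-1)(|v|-1)}[v,u]_{SN}$. For $1$-forms $\xi,\eta$ put $$[\xi,\eta]^{P}=L_{P^\sharp\xi}\eta-L_{P^\sharp\eta}\xi-\mathrm d\big(P(\xi,\eta)\big),\qquad [\xi,\eta]^{P,\psi}=[\xi,\eta]^P+i_{P^\sharp\xi\wedge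 P^\sharp\eta}\psi .$$ There is exactly one derivation $d_{P,\psi}$ of $V^\bullet(M)$ associated with this bracket and the anchor $P^\sharp$, i.e. exactly one $\mathbb R$-linear map $d_{P,\psi}:V^\bullet(M)\to V^\bullet(M)$ with $d_{P,\psi}(u\wedge v)=d_{P,\psi}u\wedge v+(-1)^{|u|}u\wedge d_{P,\psi}v$ that maps functions $f$ to vector fields and vector fields $x$ to bivector fields with $$(d_{P,\psi}f)(\xi)=(P^\sharp\xi)f,\qquad (d_{P,\psi}x)(\xi,\eta)=P^\sharp\xi\,\langle\eta,x\rangle-P^\sharp\eta\,\langle\xi,x\rangle-\langle[\xi,\eta]^{P,\psi},x\rangle$$ for all $1$-forms $\xi,\eta$. It is $$d_{P,\psi}=d_P+i_{(\wedge^2P^\sharp)(\psi)}\quad\text{on } V^\bullet(M),$$ where $d_P=[P,\cdot\,]_{SN}$, $(\wedge^2P^\sharp)(\psi)$ is the bivector-valued $1$-form with $(\wedge^2P^\sharp)(\psi)(x)(\xi,\eta)=\psi(P^\sharp\xi,P^\sharp\eta,x)$, and, for a bivector-valued $1$-form $B$, $i_B$ is the $C^\infty(M)$-linear derivation of $V^\bullet(M)$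 of degree $1$ with $i_Bx=B(x)$ for vector fields $x$. -/

import Mathlib

open scoped Manifold ContDiff

noncomputable section

namespace PoissonBackground

/-- The model space `ℝⁿ`. -/
abbrev Model (n : ℕ) : Type := EuclideanSpace ℝ (Fin n)

section Algebra

variable {V : Type*} [AddCommGroup V] [Module ℝ V]

/-- Contraction `i_ξ u` of a multivector `u ∈ ⋀V` by a covector `ξ`: the antiderivation of `⋀V`
with `i_ξ v = ξ(v)` for `v ∈ V`. For a bivector `u`, this is `i_ξ u = u(ξ, ·)`. -/
def contr (ξ : Module.Dual ℝ V) : ExteriorAlgebra ℝ V →ₗ[ℝ] ExteriorAlgebra ℝ V :=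
  CliffordAlgebra.contractLeft ξ

/-- The value `u(ξ)` of a multivector of degree one on a covector. -/
def eval₁ (u : ExteriorAlgebra ℝ V) (ξ : Module.Dual ℝ V) : ℝ :=
  ExteriorAlgebra.algebraMapInv (contr ξ u)

/-- The value `u(ξ, η) = i_η i_ξ u` of a multivector of degree two on a pair of covectors, so that
`(v ∧ w)(ξ, η) = ξ(v) η(w) - η(v) ξ(w)`. -/
def eval₂ (u : ExteriorAlgebra ℝ V) (ξ η : Module.Dual ℝ V) : ℝ :=
  ExteriorAlgebra.algebraMapInv (contr η (contr ξ u))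

theorem eval₁_ι (v : V) (ξ : Module.Dual ℝ V) : eval₁ (ExteriorAlgebra.ι ℝ v) ξ = ξ v := by
  have h : contr ξ (ExteriorAlgebra.ι ℝ v) = algebraMap ℝ (ExteriorAlgebra ℝ V) (ξ v) :=
    CliffordAlgebra.contractLeft_ι _ _ _
  rw [eval₁, h]
  exact ExteriorAlgebra.algebraMap_leftInverse V (ξ v)

theorem eval₂_ι_mul_ι (v w : V) (ξ η : Module.Dual ℝ V) :
    eval₂ (ExteriorAlgebra.ι ℝ v * ExteriorAlgebra.ι ℝ w) ξ η = ξ v * η w - η v * ξ w := by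
  have h : ∀ (ζ : Module.Dual ℝ V) (z : V),
      contr ζ (ExteriorAlgebra.ι ℝ z) = algebraMap ℝ (ExteriorAlgebra ℝ V) (ζ z) :=
    fun ζ z => CliffordAlgebra.contractLeft_ι _ _ _
  have h2 : contr ξ (ExteriorAlgebra.ι ℝ v * ExteriorAlgebra.ι ℝ w) =
      ξ v • ExteriorAlgebra.ι ℝ w
        - ExteriorAlgebra.ι ℝ v * contr ξ (ExteriorAlgebra.ι ℝ w) :=
    CliffordAlgebra.contractLeft_ι_mul _ _ _
  have h3 : ∀ r : ℝ, ExteriorAlgebra.algebraMapInv (algebraMap ℝ (ExteriorAlgebra ℝ V) r) = r :=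
    ExteriorAlgebra.algebraMap_leftInverse V
  rw [eval₂, h2, h, ← Algebra.commutes, ← Algebra.smul_def, map_sub, map_smul, map_smul, h, h,
    map_sub, map_smul, map_smul, h3, h3, smul_eq_mul, smul_eq_mul]
  ring

/-- The contraction `i_v α = α(v, ·, …)` of a form by a vector. -/
def contrForm {k : ℕ} (v : V) (α : V [⋀^Fin (k + 1)]→ₗ[ℝ] ℝ) : V [⋀^Fin k]→ₗ[ℝ] ℝ :=
  α.curryLeft v

/-- The contraction `i_{v ∧ w} ψ` of a `3`-form by a decomposable bivector, with the convention
`i_{v ∧ w} = i_v ∘ i_w`. -/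
def contrForm₂ (v w : V) (ψ : V [⋀^Fin 3]→ₗ[ℝ] ℝ) : Module.Dual ℝ V :=
  (AlternatingMap.ofSubsingleton ℝ V ℝ (0 : Fin 1)).symm (contrForm v (contrForm w ψ))

theorem contrForm₂_apply (v w z : V) (ψ : V [⋀^Fin 3]→ₗ[ℝ] ℝ) :
    contrForm₂ v w ψ z = ψ ![w, v, z] := by
  change ψ (Matrix.vecCons w (Matrix.vecCons v fun _ => z)) = _
  congr 1
  ext i
  fin_cases i <;> rfl

end Algebra

section Manifold

variable {n : ℕ} {M : Type*} [TopologicalSpace M] [ChartedSpace (Model n) M]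

/-- The exterior algebra `⋀ T_x M`. -/
abbrev Fiber (n : ℕ) {M : Type*} [TopologicalSpace M] [ChartedSpace (Model n) M] (x : M) : Type :=
  ExteriorAlgebra ℝ (TangentSpace (𝓡 n) x)

/-- The standard basis `e_I = e_{i₁} ∧ … ∧ e_{i_k}`, `I = {i₁ < … < i_k}`, of `⋀ ℝⁿ`. -/
def extBasis (n : ℕ) : Module.Basis (Finset (Fin n)) ℝ (ExteriorAlgebra ℝ (Model n)) :=
  (EuclideanSpace.basisFun (Fin n) ℝ).toBasis.ExteriorAlgebra

/-- The vector `e_i = ∂/∂xⁱ` of `T_x M = ℝⁿ`, for the preferred chart at `x`. -/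
def coordVec (x : M) (i : Fin n) : TangentSpace (𝓡 n) x :=
  (EuclideanSpace.single i (1 : ℝ) : Model n)

/-- The covector `eⁱ = dxⁱ` at `x`, for the preferred chart at `x`. -/
def coordCovec (x : M) (i : Fin n) : Module.Dual ℝ (TangentSpace (𝓡 n) x) :=
  ((EuclideanSpace.proj i : Model n →L[ℝ] ℝ) : Model n →ₗ[ℝ] ℝ)

/-- The differential of a function at a point, as a covector. -/
def dFun (f : M → ℝ) (x : M) : Module.Dual ℝ (TangentSpace (𝓡 n) x) :=
  ((NormedSpace.fromTangentSpace (𝕜 := ℝ) (f x)).toContinuousLinearMap ∘L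
    mfderiv (𝓡 n) 𝓘(ℝ, ℝ) f x : TangentSpace (𝓡 n) x →L[ℝ] ℝ)

variable [IsManifold (𝓡 n) ∞ M]

/-- The component along `e_I` of a field of multivectors in the chart at `x₀`, at the point `y`. -/
def coeff (x₀ : M) (s : Finset (Fin n)) (u : ∀ x : M, Fiber n x) (y : M) : ℝ :=
  (extBasis n).repr (ExteriorAlgebra.map
    ((trivializationAt (Model n) (TangentSpace (𝓡 n)) x₀).continuousLinearMapAt ℝ y :
      TangentSpace (𝓡 n) y →ₗ[ℝ] Model n) (u y)) s

/-- A field of multivectors is smooth if its components in the charts of `M` are. -/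
def IsSmoothMV (u : ∀ x : M, Fiber n x) : Prop :=
  ∀ (x₀ : M) (s : Finset (Fin n)),
    ContMDiffOn (𝓡 n) 𝓘(ℝ, ℝ) ∞ (coeff x₀ s u) (chartAt (Model n) x₀).source

theorem coeff_add (x₀ : M) (s : Finset (Fin n)) (u v : ∀ x : M, Fiber n x) :
    coeff x₀ s (u + v) = coeff x₀ s u + coeff x₀ s v := by
  funext y; simp [coeff]

/-- Structure constants of `⋀ ℝⁿ` give the components of a product. -/
theorem coeff_mul (x₀ : M) (s : Finset (Fin n)) (u v : ∀ x : M, Fiber n x) :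
    coeff x₀ s (u * v) = fun y => ∑ a, ∑ b, coeff x₀ a u y * coeff x₀ b v y *
      (extBasis n).repr (extBasis n a * extBasis n b) s := by
  funext y
  simp only [coeff, Pi.mul_apply, map_mul]
  set U := ExteriorAlgebra.map
    ((trivializationAt (Model n) (TangentSpace (𝓡 n)) x₀).continuousLinearMapAt ℝ y :
      TangentSpace (𝓡 n) y →ₗ[ℝ] Model n) (u y)
  set W := ExteriorAlgebra.map
    ((trivializationAt (Model n) (TangentSpace (𝓡 n)) x₀).continuousLinearMapAt ℝ y :
      TangentSpace (𝓡 n) y →ₗ[ℝ] Model n) (v y)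
  conv_lhs => rw [← (extBasis n).sum_repr U, ← (extBasis n).sum_repr W]
  simp only [Finset.sum_mul, Finset.mul_sum, smul_mul_assoc, mul_smul_comm, map_sum, map_smul,
    Finsupp.coe_finsetSum, Finset.sum_apply, Finsupp.smul_apply, smul_eq_mul]
  rw [Finset.sum_comm]
  refine Finset.sum_congr rfl fun a _ => Finset.sum_congr rfl fun b _ => ?_
  ring

theorem IsSmoothMV.of_fun {f : M → ℝ} (hf : ContMDiff (𝓡 n) 𝓘(ℝ, ℝ) ∞ f) :
    IsSmoothMV (fun x : M => algebraMap ℝ (Fiber n x) (f x)) := by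
  intro x₀ s
  have h : coeff x₀ s (fun x : M => algebraMap ℝ (Fiber n x) (f x)) =
      fun y => f y * (extBasis n).repr 1 s := by
    funext y
    simp [coeff, Algebra.algebraMap_eq_smul_one]
  rw [h]
  exact (hf.mul contMDiff_const).contMDiffOn

theorem IsSmoothMV.of_vec (X : Cₛ^∞⟮𝓡 n; Model n, (TangentSpace (𝓡 n) : M → Type)⟯) :
    IsSmoothMV (fun x : M => ExteriorAlgebra.ι ℝ (X x)) := by
  intro x₀ s
  set e := trivializationAt (Model n) (TangentSpace (𝓡 n) : M → Type) x₀ with he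
  have hX := (e.contMDiffOn_section_baseSet_iff (IB := 𝓡 n) (n := ∞) (s := fun x => X x)).1
    X.contMDiff.contMDiffOn
  let L : Model n →L[ℝ] ℝ := LinearMap.toContinuousLinearMap
    (((extBasis n).coord s) ∘ₗ ExteriorAlgebra.ι ℝ)
  have h2 := (L.contMDiff (n := ∞)).comp_contMDiffOn hX
  have hb : e.baseSet = (chartAt (Model n) x₀).source := TangentBundle.trivializationAt_baseSet x₀
  rw [← hb]
  refine h2.congr fun y hy => ?_
  have := e.continuousLinearMapAt_apply_of_mem (R := ℝ) hy (X y)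
  simp [coeff, ← he, L, this]

/-- The algebra `V^•(M) = Γ(⋀TM)` of smooth multivector fields on `M`, with the exterior product
as multiplication. -/
def MultiVec (n : ℕ) (M : Type*) [TopologicalSpace M] [ChartedSpace (Model n) M]
    [IsManifold (𝓡 n) ∞ M] : Subalgebra ℝ (∀ x : M, Fiber n x) where
  carrier := {u | IsSmoothMV u}
  mul_mem' := by
    intro u v hu hv x₀ s
    rw [coeff_mul]
    refine contMDiffOn_finsetSum fun a _ => contMDiffOn_finsetSum fun b _ => ?_
    exact ((hu x₀ a).mul (hv x₀ b)).mul contMDiffOn_const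
  add_mem' := by
    intro u v hu hv x₀ s
    rw [coeff_add]
    exact (hu x₀ s).add (hv x₀ s)
  algebraMap_mem' := fun r => IsSmoothMV.of_fun (f := fun _ => r) contMDiff_const

/-- A smooth function as a multivector field of degree zero. -/
def ofFun (f : C^∞⟮𝓡 n, M; ℝ⟯) : MultiVec n M :=
  ⟨fun x => algebraMap ℝ (Fiber n x) (f x), IsSmoothMV.of_fun f.contMDiff⟩

/-- Smooth vector fields on `M`. -/
abbrev VecField (n : ℕ) (M : Type*) [TopologicalSpace M] [ChartedSpace (Model n) M]
    [IsManifold (𝓡 n) ∞ M] : Type _ :=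
  Cₛ^∞⟮𝓡 n; Model n, (TangentSpace (𝓡 n) : M → Type)⟯

/-- A smooth vector field as a multivector field of degree one. -/
def ofVec (X : VecField n M) : MultiVec n M :=
  ⟨fun x => ExteriorAlgebra.ι ℝ (X x), IsSmoothMV.of_vec X⟩

/-- Smooth differential `1`-forms on `M`: smooth sections of the cotangent bundle. -/
abbrev OneForm (n : ℕ) (M : Type*) [TopologicalSpace M] [ChartedSpace (Model n) M]
    [IsManifold (𝓡 n) ∞ M] : Type _ :=
  Cₛ^∞⟮𝓡 n; Model n →L[ℝ] ℝ, fun x : M => TangentSpace (𝓡 n) x →L[ℝ] Bundle.Trivial M ℝ x⟯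

/-- The value of a `1`-form at a point. -/
def OneForm.at (ξ : OneForm n M) (x : M) : Module.Dual ℝ (TangentSpace (𝓡 n) x) :=
  ((ξ x : TangentSpace (𝓡 n) x →L[ℝ] ℝ) : TangentSpace (𝓡 n) x →ₗ[ℝ] ℝ)

/-- Smooth differential forms of degree `k` on `M`: fields of alternating `k`-linear forms on the
tangent spaces that are smooth in the charts of `M`. -/
structure DiffForm (n : ℕ) (M : Type*) [TopologicalSpace M] [ChartedSpace (Model n) M]
    [IsManifold (𝓡 n) ∞ M] (k : ℕ) where
  /-- the underlying field of alternating forms -/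
  toFun : ∀ x : M, TangentSpace (𝓡 n) x [⋀^Fin k]→L[ℝ] ℝ
  /-- smoothness in the charts -/
  smooth : ∀ x₀ : M, ContMDiffOn (𝓡 n) 𝓘(ℝ, Model n [⋀^Fin k]→L[ℝ] ℝ) ∞
    (fun y => (toFun y).compContinuousLinearMap
      ((trivializationAt (Model n) (TangentSpace (𝓡 n)) x₀).symmL ℝ y))
    (chartAt (Model n) x₀).source

/-- The value of a form at a point. -/
def DiffForm.at {k : ℕ} (ψ : DiffForm n M k) (x : M) :
    TangentSpace (𝓡 n) x [⋀^Fin k]→ₗ[ℝ] ℝ :=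
  (ψ.toFun x).toAlternatingMap

/-! ### The Schouten–Nijenhuis bracket -/

/-- The derivative at `x` of a field of multivectors, along a vector `v ∈ T_x M`, component by
component in the chart at `x`. -/
def chartDeriv (u : ∀ x : M, Fiber n x) (x : M) (v : TangentSpace (𝓡 n) x) : Fiber n x :=
  (∑ s : Finset (Fin n), dFun (coeff x s u) x v • extBasis n s : ExteriorAlgebra ℝ (Model n))

/-- The Schouten–Nijenhuis bracket `[u, v]_{SN}` of multivector fields, by its expression in local
coordinates: in the chart at `x`, for `u` of degree `p`,
`[u, v] = ∑ᵢ ((-1)^(p-1) i_{dxⁱ} u ∧ ∂ᵢ v - ∂ᵢ u ∧ i_{dxⁱ} v)`.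
It extends the Lie bracket of vector fields `[X, Y]` and the action `[X, f] = X f` of vector fields
on functions, and `[u, v ∧ w] = [u, v] ∧ w + (-1)^((p-1)q) v ∧ [u, w]` for `v` of degree `q`. -/
def schouten (u v : ∀ x : M, Fiber n x) (x : M) : Fiber n x :=
  ∑ i : Fin n,
    (CliffordAlgebra.involute (contr (coordCovec x i) (u x)) * chartDeriv v x (coordVec x i)
      - chartDeriv u x (coordVec x i) * contr (coordCovec x i) (v x))

/-! ### Bivectors, and brackets of `1`-forms -/

/-- `P^♯ ξ = i_ξ P`, the vector field with `η(P^♯ ξ) = P(ξ, η)`. -/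
def sharp (P : ∀ x : M, Fiber n x) (x : M) (ξ : Module.Dual ℝ (TangentSpace (𝓡 n) x)) :
    TangentSpace (𝓡 n) x :=
  ExteriorAlgebra.ιInv (contr ξ (P x))

/-- The derivative at `x` of a `1`-form, component by component in the chart at `x`:
the bilinear form `(u, v) ↦ ∑ u^i v^j ∂ᵢ ξⱼ`. -/
def OneForm.chartDeriv (ξ : OneForm n M) (x : M) : Model n →L[ℝ] (Model n →L[ℝ] ℝ) :=
  (NormedSpace.fromTangentSpace (𝕜 := ℝ) (E := Model n →L[ℝ] ℝ) _).toContinuousLinearMap ∘L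
    mfderiv (𝓡 n) 𝓘(ℝ, Model n →L[ℝ] ℝ)
      (fun y : M => ((ξ y : TangentSpace (𝓡 n) y →L[ℝ] ℝ) ∘L
        (trivializationAt (Model n) (TangentSpace (𝓡 n)) x).symmL ℝ y : Model n →L[ℝ] ℝ)) x

/-- The exterior derivative of a `1`-form, `(dξ)(u, v) = ∑ (∂ᵢ ξⱼ - ∂ⱼ ξᵢ) u^i v^j`. -/
def OneForm.d (ξ : OneForm n M) (x : M) :
    TangentSpace (𝓡 n) x →ₗ[ℝ] Module.Dual ℝ (TangentSpace (𝓡 n) x) :=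
  let A : Model n →ₗ[ℝ] Model n →ₗ[ℝ] ℝ := (ContinuousLinearMap.coeLM ℝ) ∘ₗ ξ.chartDeriv x
  (A - A.flip : Model n →ₗ[ℝ] Model n →ₗ[ℝ] ℝ)

/-- The Lie derivative of a `1`-form along a vector field, `L_X ξ = i_X dξ + d(ξ(X))`. -/
def OneForm.lie (X : ∀ x : M, TangentSpace (𝓡 n) x) (ξ : OneForm n M) (x : M) :
    Module.Dual ℝ (TangentSpace (𝓡 n) x) :=
  ξ.d x (X x) + dFun (fun y => ξ.at y (X y)) x

/-- The bracket `[ξ, η]^P = L_{P^♯ξ} η - L_{P^♯η} ξ - d(P(ξ, η))` of `1`-forms. -/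
def koszul (P : ∀ x : M, Fiber n x) (ξ η : OneForm n M) (x : M) :
    Module.Dual ℝ (TangentSpace (𝓡 n) x) :=
  OneForm.lie (fun y => sharp P y (ξ.at y)) η x - OneForm.lie (fun y => sharp P y (η.at y)) ξ x
    - dFun (fun y => eval₂ (P y) (ξ.at y) (η.at y)) x

/-- The bracket `[ξ, η]^{P,ψ} = [ξ, η]^P + i_{P^♯ξ ∧ P^♯η} ψ` of `1`-forms. -/
def bracket (P : ∀ x : M, Fiber n x) (ψ : DiffForm n M 3) (ξ η : OneForm n M) (x : M) :
    Module.Dual ℝ (TangentSpace (𝓡 n) x) :=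
  koszul P ξ η x + contrForm₂ (sharp P x (ξ.at x)) (sharp P x (η.at x)) (ψ.at x)

/-- `D` is the derivation `d_{P,ψ}` of `V^•(M)` associated with the bracket `[·, ·]^{P,ψ}` of
`1`-forms and with the anchor `P^♯`: it is an `ℝ`-linear derivation of odd degree with
`(D f)(ξ) = (P^♯ξ) f` and `(D X)(ξ, η) = P^♯ξ ⟨η, X⟩ - P^♯η ⟨ξ, X⟩ - ⟨[ξ, η]^{P,ψ}, X⟩`. -/
structure IsAssociatedDerivation (P : ∀ x : M, Fiber n x) (ψ : DiffForm n M 3)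
    (D : MultiVec n M →ₗ[ℝ] MultiVec n M) : Prop where
  /-- `D(u ∧ v) = Du ∧ v + (-1)^p u ∧ Dv` for `u` of degree `p` -/
  leibniz : ∀ (u v : MultiVec n M) (x : M),
    (D (u * v)).1 x = (D u).1 x * v.1 x + CliffordAlgebra.involute (u.1 x) * (D v).1 x
  /-- `D` maps functions to vector fields -/
  degree_fun : ∀ (f : C^∞⟮𝓡 n, M; ℝ⟯) (x : M), (D (ofFun f)).1 x ∈ ⋀[ℝ]^1 (TangentSpace (𝓡 n) x)
  /-- the values of `D` on functions -/
  eval_fun : ∀ (f : C^∞⟮𝓡 n, M; ℝ⟯) (ξ : OneForm n M) (x : M),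
    eval₁ ((D (ofFun f)).1 x) (ξ.at x) = dFun f x (sharp P x (ξ.at x))
  /-- `D` maps vector fields to bivector fields -/
  degree_vec : ∀ (X : VecField n M) (x : M),
    (D (ofVec X)).1 x ∈ ⋀[ℝ]^2 (TangentSpace (𝓡 n) x)
  /-- the values of `D` on vector fields -/
  eval_vec : ∀ (X : VecField n M) (ξ η : OneForm n M) (x : M),
    eval₂ ((D (ofVec X)).1 x) (ξ.at x) (η.at x) =
      dFun (fun y => η.at y (X y)) x (sharp P x (ξ.at x))
        - dFun (fun y => ξ.at y (X y)) x (sharp P x (η.at x))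
        - bracket P ψ ξ η x (X x)

/-! ### The interior product by a bivector-valued `1`-form -/

/-- The value at `v ∈ T_x M` of the bivector-valued `1`-form `(⋀²P^♯)(ψ)`: the bivector with
`(⋀²P^♯)(ψ)(v)(ξ, η) = ψ(P^♯ξ, P^♯η, v)`, written in the basis `e_i ∧ e_j`. -/
def sharpSq (P : ∀ x : M, Fiber n x) (ψ : DiffForm n M 3) (x : M) (v : TangentSpace (𝓡 n) x) :
    Fiber n x :=
  (2 : ℝ)⁻¹ • ∑ i : Fin n, ∑ j : Fin n,
    ψ.at x ![sharp P x (coordCovec x i), sharp P x (coordCovec x j), v] •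
      (ExteriorAlgebra.ι ℝ (coordVec x i) * ExteriorAlgebra.ι ℝ (coordVec x j))

/-- The interior product `i_B` of multivector fields by a bivector-valued `1`-form `B`, the
`C^∞(M)`-linear derivation of `V^•(M)` with `i_B X = B(X)`: `i_B u = ∑ᵢ B(eᵢ) ∧ i_{eⁱ} u`. -/
def interior (B : ∀ x : M, TangentSpace (𝓡 n) x → Fiber n x) (u : ∀ x : M, Fiber n x) (x : M) :
    Fiber n x :=
  ∑ i : Fin n, B x (coordVec x i) * contr (coordCovec x i) (u x)

end Manifold

end PoissonBackground

end

noncomputable section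

namespace PoissonBackground

/-! ### Exterior algebra: contraction, graded commutativity, elements of degree one and two. -/

section Algebra

variable {V : Type*} [AddCommGroup V] [Module ℝ V]

/-! The operator `[P, ·] + i_B` with `B = (⋀²P^♯)(ψ)`, called `twistedOp`, has the defining
properties of the derivation, and these properties leave no other choice.

Existence is a pointwise computation in the chart at the point. The Leibniz rule (`twistedOp_mul`)
holds summand by summand: partial derivatives are derivations, contractions are antiderivations,
`P^♯dxⁱ` has degree one, and the bivectors `∂ᵢP` and `B(eᵢ)` commute with everything. On a function
the operator gives `-P^♯df`. On a vector field `X` its value on `(ξ, η)` is `η(∂_{P^♯ξ}X) -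
ξ(∂_{P^♯η}X) - (∂_X P)(ξ, η) + ψ(P^♯ξ, P^♯η, X)`. By `koszul_apply`, `[ξ, η]^P(X) = (∂_{P^♯ξ}η)(X) -
(∂_{P^♯η}ξ)(X) + (∂_X P)(ξ, η)`, so the derivatives of `ξ` and `η` drop out of the prescribed value
and the two expressions agree (`eval₂_twistedOp_eq_bracket`). The `ψ` term has the right sign
because `i_{v∧w}ψ = -ψ(v, w, ·)`.

Smoothness of the result needs an argument, since the defining formula uses a different chart at
each point. On functions and vector fields it is read off from values on exact forms, which are
chart-free: `[df, dg]^P = d(P(df, dg))`. The general case follows by the Leibniz rule and locality,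
because every multivector field is locally a polynomial in global functions and vector fields
(`exists_poly_eventuallyEq`).

The same fact gives uniqueness. A derivation is local, by bump functions, and its values on
functions and vector fields are prescribed on differentials of functions, which exhaust the
covectors at each point. -/

theorem contr_ι (ξ : Module.Dual ℝ V) (v : V) :
    contr ξ (ExteriorAlgebra.ι ℝ v) = algebraMap ℝ (ExteriorAlgebra ℝ V) (ξ v) :=
  CliffordAlgebra.contractLeft_ι _ _ _

theorem contr_algebraMap (ξ : Module.Dual ℝ V) (r : ℝ) :
    contr ξ (algebraMap ℝ (ExteriorAlgebra ℝ V) r) = 0 :=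
  CliffordAlgebra.contractLeft_algebraMap _ _ _

theorem contr_ι_mul (ξ : Module.Dual ℝ V) (v : V) (u : ExteriorAlgebra ℝ V) :
    contr ξ (ExteriorAlgebra.ι ℝ v * u) = ξ v • u - ExteriorAlgebra.ι ℝ v * contr ξ u :=
  CliffordAlgebra.contractLeft_ι_mul _ _ _

theorem involute_ι' (v : V) :
    CliffordAlgebra.involute (ExteriorAlgebra.ι ℝ v) = -ExteriorAlgebra.ι ℝ v :=
  CliffordAlgebra.involute_ι v

/-- Contraction by a covector is an antiderivation. -/
theorem contr_mul (ξ : Module.Dual ℝ V) (u v : ExteriorAlgebra ℝ V) :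
    contr ξ (u * v) = contr ξ u * v + CliffordAlgebra.involute u * contr ξ v := by
  induction u using CliffordAlgebra.left_induction with
  | algebraMap r => rw [contr_algebraMap, ← Algebra.smul_def, map_smul, AlgHom.commutes, zero_mul,
      zero_add, Algebra.smul_def]
  | add x y hx hy => rw [add_mul, map_add, hx, hy, map_add, map_add]; noncomm_ring
  | ι_mul x m hx =>
    have h := contr_ι_mul ξ m x
    have h' := contr_ι_mul ξ m (x * v)
    rw [mul_assoc, h', h, hx, map_mul, involute_ι', sub_mul, smul_mul_assoc]
    noncomm_ring

/-- Graded commutativity with a vector: the grade involution carries the sign `(-1)^p`, so `u` need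
not be homogeneous. -/
theorem ι_mul_comm' (m : V) (u : ExteriorAlgebra ℝ V) :
    ExteriorAlgebra.ι ℝ m * u = CliffordAlgebra.involute u * ExteriorAlgebra.ι ℝ m := by
  induction u using CliffordAlgebra.left_induction with
  | algebraMap r => rw [AlgHom.commutes, Algebra.commutes]
  | add x y hx hy => rw [mul_add, hx, hy, map_add, add_mul]
  | ι_mul x a hx =>
    have h := ExteriorAlgebra.ι_add_mul_swap (R := ℝ) m a
    have h2 := eq_neg_of_add_eq_zero_left h
    rw [← mul_assoc, h2, map_mul, involute_ι', neg_mul, mul_assoc, hx]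
    noncomm_ring

theorem exteriorPower_two_eq :
    ⋀[ℝ]^2 V = LinearMap.range (ExteriorAlgebra.ι ℝ (M := V)) *
      LinearMap.range (ExteriorAlgebra.ι ℝ (M := V)) :=
  pow_two _

theorem ι_mul_ι_mem (v w : V) :
    ExteriorAlgebra.ι ℝ v * ExteriorAlgebra.ι ℝ w ∈ ⋀[ℝ]^2 V := by
  rw [exteriorPower_two_eq]
  exact Submodule.mul_mem_mul ⟨v, rfl⟩ ⟨w, rfl⟩

@[elab_as_elim]
theorem exteriorPower_two_induction {C : ∀ u : ExteriorAlgebra ℝ V, u ∈ ⋀[ℝ]^2 V → Prop}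
    (mul : ∀ v w, C (ExteriorAlgebra.ι ℝ v * ExteriorAlgebra.ι ℝ w) (ι_mul_ι_mem v w))
    (add : ∀ x hx y hy, C x hx → C y hy → C (x + y) (add_mem hx hy)) {u : ExteriorAlgebra ℝ V}
    (hu : u ∈ ⋀[ℝ]^2 V) : C u hu := by
  have hu' := hu
  rw [exteriorPower_two_eq] at hu'
  suffices h : ∃ hu, C u hu from h.2
  induction hu' using Submodule.mul_induction_on' with
  | mem_mul_mem a ha b hb =>
    obtain ⟨v, rfl⟩ := ha
    obtain ⟨w, rfl⟩ := hb
    exact ⟨_, mul v w⟩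
  | add x hx y hy h1 h2 =>
    rw [← exteriorPower_two_eq] at hx hy
    exact ⟨_, add x _ y _ (h1 hx).2 (h2 hy).2⟩

theorem mem_exteriorPower_one {u : ExteriorAlgebra ℝ V} :
    u ∈ ⋀[ℝ]^1 V ↔ ∃ v, ExteriorAlgebra.ι ℝ v = u := by
  have h : ⋀[ℝ]^1 V = LinearMap.range (ExteriorAlgebra.ι ℝ (M := V)) := pow_one _
  rw [h]
  rfl

/-- Moving past a product of two vectors applies the grade involution twice. -/
theorem commute_of_mem_two {u : ExteriorAlgebra ℝ V} (hu : u ∈ ⋀[ℝ]^2 V)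
    (w : ExteriorAlgebra ℝ V) : u * w = w * u := by
  induction hu using exteriorPower_two_induction with
  | mul a b =>
    rw [mul_assoc, ι_mul_comm' b w, ← mul_assoc, ι_mul_comm' a, CliffordAlgebra.involute_involute,
      mul_assoc]
  | add x _ y _ hx hy => rw [add_mul, mul_add, hx, hy]

theorem exists_contr_eq_ι {u : ExteriorAlgebra ℝ V} (hu : u ∈ ⋀[ℝ]^2 V) (ξ : Module.Dual ℝ V) :
    ∃ v, contr ξ u = ExteriorAlgebra.ι ℝ v := by
  induction hu using exteriorPower_two_induction with
  | mul a b =>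
    refine ⟨ξ a • b - ξ b • a, ?_⟩
    rw [contr_ι_mul, contr_ι, ← Algebra.commutes, ← Algebra.smul_def, map_sub, map_smul, map_smul]
  | add x _ y _ hx hy =>
    obtain ⟨v, hv⟩ := hx
    obtain ⟨w, hw⟩ := hy
    exact ⟨v + w, by rw [map_add, hv, hw, map_add]⟩

/-- The contraction of a bivector is already a vector, so the projection `ιInv` used to define
`sharp` loses nothing. -/
theorem contr_eq_ι_ιInv {u : ExteriorAlgebra ℝ V} (hu : u ∈ ⋀[ℝ]^2 V) (ξ : Module.Dual ℝ V) :
    contr ξ u = ExteriorAlgebra.ι ℝ (ExteriorAlgebra.ιInv (contr ξ u)) := by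
  obtain ⟨v, hv⟩ := exists_contr_eq_ι hu ξ
  rw [hv, ExteriorAlgebra.ι_leftInverse]

theorem eval₂_eq_of_mem_two {u : ExteriorAlgebra ℝ V} (hu : u ∈ ⋀[ℝ]^2 V)
    (ξ η : Module.Dual ℝ V) : eval₂ u ξ η = η (ExteriorAlgebra.ιInv (contr ξ u)) := by
  conv_lhs => rw [eval₂, contr_eq_ι_ιInv hu, contr_ι]
  exact ExteriorAlgebra.algebraMap_leftInverse V _

theorem eval₂_swap (u : ExteriorAlgebra ℝ V) (ξ η : Module.Dual ℝ V) :
    eval₂ u ξ η = -eval₂ u η ξ := by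
  rw [eval₂, eval₂, ← map_neg]
  exact congrArg _ (CliffordAlgebra.contractLeft_comm _ _ _)

theorem eval₂_add (u v : ExteriorAlgebra ℝ V) (ξ η : Module.Dual ℝ V) :
    eval₂ (u + v) ξ η = eval₂ u ξ η + eval₂ v ξ η := by
  simp only [eval₂, map_add]

theorem eval₂_sub (u v : ExteriorAlgebra ℝ V) (ξ η : Module.Dual ℝ V) :
    eval₂ (u - v) ξ η = eval₂ u ξ η - eval₂ v ξ η := by
  simp only [eval₂, map_sub]

theorem eval₂_neg (u : ExteriorAlgebra ℝ V) (ξ η : Module.Dual ℝ V) :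
    eval₂ (-u) ξ η = -eval₂ u ξ η := by
  simp only [eval₂, map_neg]

theorem eval₂_smul (r : ℝ) (u : ExteriorAlgebra ℝ V) (ξ η : Module.Dual ℝ V) :
    eval₂ (r • u) ξ η = r * eval₂ u ξ η := by
  simp only [eval₂, map_smul, smul_eq_mul]

theorem eval₂_sum {κ : Type*} (s : Finset κ) (u : κ → ExteriorAlgebra ℝ V)
    (ξ η : Module.Dual ℝ V) : eval₂ (∑ i ∈ s, u i) ξ η = ∑ i ∈ s, eval₂ (u i) ξ η := by
  simp only [eval₂, map_sum]

/-- Naturality of the contraction. -/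
theorem contr_map {W : Type*} [AddCommGroup W] [Module ℝ W] (T : V →ₗ[ℝ] W)
    (ξ : Module.Dual ℝ W) (u : ExteriorAlgebra ℝ V) :
    contr ξ (ExteriorAlgebra.map T u) = ExteriorAlgebra.map T (contr (ξ ∘ₗ T) u) := by
  induction u using CliffordAlgebra.left_induction with
  | algebraMap r =>
    rw [AlgHom.commutes, contr_algebraMap, contr_algebraMap, map_zero]
  | add x y hx hy => simp only [map_add, hx, hy]
  | ι_mul x a hx =>
    have h := ExteriorAlgebra.map_apply_ι T a
    have h2 := contr_ι_mul (ξ ∘ₗ T) a x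
    rw [map_mul, h, contr_ι_mul, hx, h2, map_sub, map_smul, map_mul, h]
    rfl

theorem map_involute {W : Type*} [AddCommGroup W] [Module ℝ W] (T : V →ₗ[ℝ] W)
    (u : ExteriorAlgebra ℝ V) :
    ExteriorAlgebra.map T (CliffordAlgebra.involute u) =
      CliffordAlgebra.involute (ExteriorAlgebra.map T u) := by
  induction u using CliffordAlgebra.left_induction with
  | algebraMap r => simp only [AlgHom.commutes]
  | add x y hx hy => simp only [map_add, hx, hy]
  | ι_mul x a hx =>
    have h := ExteriorAlgebra.map_apply_ι T a
    rw [map_mul, map_mul, map_mul, map_mul, hx, involute_ι', map_neg, h, involute_ι']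

theorem algebraMapInv_map {W : Type*} [AddCommGroup W] [Module ℝ W] (T : V →ₗ[ℝ] W)
    (u : ExteriorAlgebra ℝ V) :
    ExteriorAlgebra.algebraMapInv (ExteriorAlgebra.map T u) =
      ExteriorAlgebra.algebraMapInv u := by
  have : (ExteriorAlgebra.algebraMapInv.comp (ExteriorAlgebra.map T) : _ →ₐ[ℝ] ℝ) =
      ExteriorAlgebra.algebraMapInv := by
    ext v
    simp [ExteriorAlgebra.algebraMapInv]
  exact DFunLike.congr_fun this u

theorem eval₁_map {W : Type*} [AddCommGroup W] [Module ℝ W] (T : V →ₗ[ℝ] W)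
    (ξ : Module.Dual ℝ W) (u : ExteriorAlgebra ℝ V) :
    eval₁ (ExteriorAlgebra.map T u) ξ = eval₁ u (ξ ∘ₗ T) := by
  rw [eval₁, contr_map, algebraMapInv_map, eval₁]

theorem eval₂_map {W : Type*} [AddCommGroup W] [Module ℝ W] (T : V →ₗ[ℝ] W)
    (ξ η : Module.Dual ℝ W) (u : ExteriorAlgebra ℝ V) :
    eval₂ (ExteriorAlgebra.map T u) ξ η = eval₂ u (ξ ∘ₗ T) (η ∘ₗ T) := by
  rw [eval₂, contr_map, contr_map, algebraMapInv_map, eval₂]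

theorem map_mem_exteriorPower {W : Type*} [AddCommGroup W] [Module ℝ W] (T : V →ₗ[ℝ] W) (k : ℕ)
    {u : ExteriorAlgebra ℝ V} (hu : u ∈ ⋀[ℝ]^k V) : ExteriorAlgebra.map T u ∈ ⋀[ℝ]^k W := by
  have h := Submodule.mem_map_of_mem (f := (ExteriorAlgebra.map T).toLinearMap) hu
  have h2 : Submodule.map (ExteriorAlgebra.map T).toLinearMap
      (LinearMap.range (ExteriorAlgebra.ι ℝ (M := V))) ≤ LinearMap.range (ExteriorAlgebra.ι ℝ) := by
    rintro _ ⟨_, ⟨v, rfl⟩, rfl⟩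
    exact ⟨T v, (ExteriorAlgebra.map_apply_ι T v).symm⟩
  rw [Submodule.map_pow] at h
  exact pow_le_pow_left' h2 k h

variable {κ : Type*} [Fintype κ] (b : Module.Basis κ ℝ V)

include b in
theorem eq_sum_eval₁ {u : ExteriorAlgebra ℝ V} (hu : u ∈ ⋀[ℝ]^1 V) :
    u = ∑ i, eval₁ u (b.coord i) • ExteriorAlgebra.ι ℝ (b i) := by
  obtain ⟨v, rfl⟩ := mem_exteriorPower_one.1 hu
  simp only [eval₁_ι, ← map_smul, ← map_sum, b.coord_apply, b.sum_repr]

/-- The factor one half compensates for summing over all ordered pairs: the terms `(i, j)` and `(j,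
i)` coincide. -/
theorem eq_sum_eval₂ {u : ExteriorAlgebra ℝ V} (hu : u ∈ ⋀[ℝ]^2 V) :
    u = (2 : ℝ)⁻¹ • ∑ i, ∑ j, eval₂ u (b.coord i) (b.coord j) •
      (ExteriorAlgebra.ι ℝ (b i) * ExteriorAlgebra.ι ℝ (b j)) := by
  induction hu using exteriorPower_two_induction with
  | mul v w =>
    have key : ∀ v w : V, ∑ i, ∑ j, (b.coord i v * b.coord j w) •
        (ExteriorAlgebra.ι ℝ (b i) * ExteriorAlgebra.ι ℝ (b j)) =
        ExteriorAlgebra.ι ℝ v * ExteriorAlgebra.ι ℝ w := by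
      intro v w
      conv_rhs => rw [← b.sum_repr v, ← b.sum_repr w]
      simp only [map_sum, map_smul, Finset.sum_mul, Finset.mul_sum, smul_mul_smul_comm,
        b.coord_apply]
      exact Finset.sum_comm
    have key2 : ∑ i, ∑ j, (b.coord j v * b.coord i w) •
        (ExteriorAlgebra.ι ℝ (b i) * ExteriorAlgebra.ι ℝ (b j)) =
        ExteriorAlgebra.ι ℝ w * ExteriorAlgebra.ι ℝ v := by
      simp_rw [← key w v, mul_comm (b.coord _ v)]
    simp only [eval₂_ι_mul_ι, sub_smul, Finset.sum_sub_distrib]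
    rw [key, key2, eq_neg_of_add_eq_zero_right (ExteriorAlgebra.ι_add_mul_swap (R := ℝ) v w),
      sub_neg_eq_add, ← two_smul ℝ, smul_smul]
    norm_num
  | add x _ y _ hx hy =>
    conv_lhs => rw [hx, hy]
    simp only [eval₂_add, add_smul, Finset.sum_add_distrib, smul_add]

include b in
theorem ext_of_mem_one {u w : ExteriorAlgebra ℝ V} (hu : u ∈ ⋀[ℝ]^1 V) (hw : w ∈ ⋀[ℝ]^1 V)
    (h : ∀ ξ, eval₁ u ξ = eval₁ w ξ) : u = w := by
  rw [eq_sum_eval₁ b hu, eq_sum_eval₁ b hw]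
  simp only [h]

include b in
theorem ext_of_mem_two {u w : ExteriorAlgebra ℝ V} (hu : u ∈ ⋀[ℝ]^2 V) (hw : w ∈ ⋀[ℝ]^2 V)
    (h : ∀ ξ η, eval₂ u ξ η = eval₂ w ξ η) : u = w := by
  rw [eq_sum_eval₂ b hu, eq_sum_eval₂ b hw]
  simp only [h]

end Algebra

/-! ### Derivatives and smoothness of maps to a vector space, tested on linear functionals. -/

section Calculus

variable {n : ℕ} {M : Type*} [TopologicalSpace M] [ChartedSpace (Model n) M]
variable {W W₁ W₂ : Type*} [AddCommGroup W] [Module ℝ W] [AddCommGroup W₁] [Module ℝ W₁]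
  [AddCommGroup W₂] [Module ℝ W₂]

open Filter Topology

theorem dFun_congr {f g : M → ℝ} {x : M} (h : f =ᶠ[𝓝 x] g) : dFun (n := n) f x = dFun g x := by
  have h1 := h.mfderiv_eq (I := 𝓡 n) (I' := 𝓘(ℝ, ℝ))
  ext v
  exact DFunLike.congr_fun h1 v

theorem dFun_eq_of_hasMFDerivAt {f : M → ℝ} {x : M} {f' : TangentSpace (𝓡 n) x →L[ℝ] ℝ}
    (h : HasMFDerivAt (𝓡 n) 𝓘(ℝ, ℝ) f x f') (v : TangentSpace (𝓡 n) x) : dFun f x v = f' v :=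
  DFunLike.congr_fun h.mfderiv v

/-- Replaces a derivative valued in the tangent space of `ℝ` by one valued in `ℝ` itself, to which
the sum and product rules apply. -/
theorem hasMFDerivAt_dFun {f : M → ℝ} {x : M} (h : MDifferentiableAt (𝓡 n) 𝓘(ℝ, ℝ) f x) :
    ∃ f' : TangentSpace (𝓡 n) x →L[ℝ] ℝ, HasMFDerivAt (𝓡 n) 𝓘(ℝ, ℝ) f x f' ∧
      ∀ v, dFun f x v = f' v :=
  ⟨_, h.hasMFDerivAt, fun _ => rfl⟩

theorem dFun_const (c : ℝ) (x : M) : dFun (n := n) (fun _ : M => c) x = 0 := by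
  ext v
  exact dFun_eq_of_hasMFDerivAt (hasMFDerivAt_const c x) v

theorem dFun_mul {f g : M → ℝ} {x : M} (hf : MDifferentiableAt (𝓡 n) 𝓘(ℝ, ℝ) f x)
    (hg : MDifferentiableAt (𝓡 n) 𝓘(ℝ, ℝ) g x) (v : TangentSpace (𝓡 n) x) :
    dFun (fun y => f y * g y) x v = dFun f x v * g x + f x * dFun g x v := by
  obtain ⟨f', hf', hf2⟩ := hasMFDerivAt_dFun hf
  obtain ⟨g', hg', hg2⟩ := hasMFDerivAt_dFun hg
  rw [hf2, hg2]
  have h := dFun_eq_of_hasMFDerivAt (hf'.mul hg') v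
  refine h.trans ?_
  change f x * g' v + g x * f' v = _
  ring

theorem dFun_add {f g : M → ℝ} {x : M} (hf : MDifferentiableAt (𝓡 n) 𝓘(ℝ, ℝ) f x)
    (hg : MDifferentiableAt (𝓡 n) 𝓘(ℝ, ℝ) g x) (v : TangentSpace (𝓡 n) x) :
    dFun (fun y => f y + g y) x v = dFun f x v + dFun g x v := by
  obtain ⟨f', hf', hf2⟩ := hasMFDerivAt_dFun hf
  obtain ⟨g', hg', hg2⟩ := hasMFDerivAt_dFun hg
  rw [hf2, hg2]
  exact dFun_eq_of_hasMFDerivAt (hf'.add hg') v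

theorem mdifferentiableAt_sum {κ : Type*} (s : Finset κ) {f : κ → M → ℝ} {x : M}
    (hf : ∀ i ∈ s, MDifferentiableAt (𝓡 n) 𝓘(ℝ, ℝ) (f i) x) :
    MDifferentiableAt (𝓡 n) 𝓘(ℝ, ℝ) (fun y => ∑ i ∈ s, f i y) x := by
  classical
  induction s using Finset.induction_on with
  | empty => simpa only [Finset.sum_empty] using mdifferentiableAt_const
  | insert a s ha ih =>
    simp only [Finset.sum_insert ha]
    exact (hf a (Finset.mem_insert_self a s)).add
      (ih fun i hi => hf i (Finset.mem_insert_of_mem hi))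

theorem dFun_sum {κ : Type*} (s : Finset κ) {f : κ → M → ℝ} {x : M}
    (hf : ∀ i ∈ s, MDifferentiableAt (𝓡 n) 𝓘(ℝ, ℝ) (f i) x) (v : TangentSpace (𝓡 n) x) :
    dFun (fun y => ∑ i ∈ s, f i y) x v = ∑ i ∈ s, dFun (f i) x v := by
  classical
  induction s using Finset.induction_on with
  | empty => simp only [Finset.sum_empty, dFun_const, LinearMap.zero_apply]
  | insert a s ha ih =>
    have hs : ∀ i ∈ s, MDifferentiableAt (𝓡 n) 𝓘(ℝ, ℝ) (f i) x :=
      fun i hi => hf i (Finset.mem_insert_of_mem hi)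
    simp only [Finset.sum_insert ha]
    rw [dFun_add (hf a (Finset.mem_insert_self a s)) (mdifferentiableAt_sum s hs), ih hs]

/-- The vector `F'` is the derivative at `x` along `v` of the map `F` to a vector space, tested on linear
functionals. -/
def HasDerivAlong (F : M → W) (x : M) (v : TangentSpace (𝓡 n) x) (F' : W) : Prop :=
  ∀ ℓ : Module.Dual ℝ W, MDifferentiableAt (𝓡 n) 𝓘(ℝ, ℝ) (fun y => ℓ (F y)) x ∧
    dFun (fun y => ℓ (F y)) x v = ℓ F'

theorem HasDerivAlong.dFun_eq {f : M → ℝ} {x : M} {v : TangentSpace (𝓡 n) x} {r : ℝ}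
    (h : HasDerivAlong f x v r) : dFun f x v = r :=
  (h LinearMap.id).2

/-- Linear functionals separate the points of a vector space. -/
theorem HasDerivAlong.unique {F : M → W} {x : M} {v : TangentSpace (𝓡 n) x} {a b : W}
    (ha : HasDerivAlong F x v a) (hb : HasDerivAlong F x v b) : a = b :=
  sub_eq_zero.1 ((Module.forall_dual_apply_eq_zero_iff ℝ _).1 fun ℓ => by
    rw [map_sub, ← (ha ℓ).2, ← (hb ℓ).2, sub_self])

theorem HasDerivAlong.congr {F G : M → W} {x : M} {v : TangentSpace (𝓡 n) x} {a : W}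
    (h : HasDerivAlong F x v a) (hFG : G =ᶠ[𝓝 x] F) : HasDerivAlong G x v a := by
  intro ℓ
  have e : (fun y => ℓ (G y)) =ᶠ[𝓝 x] fun y => ℓ (F y) := hFG.mono fun y hy => congrArg ℓ hy
  exact ⟨(h ℓ).1.congr_of_eventuallyEq e, by rw [dFun_congr e, (h ℓ).2]⟩

theorem HasDerivAlong.linear {F : M → W} {x : M} {v : TangentSpace (𝓡 n) x} {a : W}
    (h : HasDerivAlong F x v a) (L : W →ₗ[ℝ] W₁) : HasDerivAlong (fun y => L (F y)) x v (L a) :=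
  fun ℓ => h (ℓ ∘ₗ L)

theorem hasDerivAlong_dFun {f : M → ℝ} {x : M} (h : MDifferentiableAt (𝓡 n) 𝓘(ℝ, ℝ) f x)
    (v : TangentSpace (𝓡 n) x) : HasDerivAlong f x v (dFun f x v) := by
  intro ℓ
  -- A linear functional on `ℝ` is multiplication by its value at `1`.
  have e : (fun y => ℓ (f y)) = fun y => ℓ 1 * f y := by
    funext y
    rw [mul_comm, ← smul_eq_mul, ← map_smul, smul_eq_mul, mul_one]
  rw [e]
  refine ⟨mdifferentiableAt_const.mul h, ?_⟩
  rw [dFun_mul mdifferentiableAt_const h, dFun_const, LinearMap.zero_apply, zero_mul, zero_add,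
    mul_comm, ← smul_eq_mul, ← map_smul, smul_eq_mul, mul_one]

/-- In finite dimension a bilinear expression is a finite sum of products of scalar components with
constant coefficients, so the scalar product rule is all that differentiation requires. -/
theorem dual_bilin_eq_sum [Module.Finite ℝ W₁] [Module.Finite ℝ W₂]
    (m : W₁ →ₗ[ℝ] W₂ →ₗ[ℝ] W) (ℓ : Module.Dual ℝ W) (a : W₁) (b : W₂) :
    ℓ (m a b) = ∑ i, ∑ j, (Module.finBasis ℝ W₁).coord i a * (Module.finBasis ℝ W₂).coord j b *
      ℓ (m (Module.finBasis ℝ W₁ i) (Module.finBasis ℝ W₂ j)) := by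
  conv_lhs => rw [← (Module.finBasis ℝ W₁).sum_repr a, ← (Module.finBasis ℝ W₂).sum_repr b]
  simp only [map_sum, map_smul, LinearMap.sum_apply, LinearMap.smul_apply, smul_eq_mul,
    Finset.mul_sum, Module.Basis.coord_apply]
  rw [Finset.sum_comm]
  refine Finset.sum_congr rfl fun i _ => Finset.sum_congr rfl fun j _ => ?_
  ring

/-- A single product rule that serves the exterior product, the contraction and the pairing of forms
with vectors. -/
theorem HasDerivAlong.bilin [Module.Finite ℝ W₁] [Module.Finite ℝ W₂] {F : M → W₁} {G : M → W₂}
    {x : M} {v : TangentSpace (𝓡 n) x} {a : W₁} {b : W₂} (hF : HasDerivAlong F x v a)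
    (hG : HasDerivAlong G x v b) (m : W₁ →ₗ[ℝ] W₂ →ₗ[ℝ] W) :
    HasDerivAlong (fun y => m (F y) (G y)) x v (m a (G x) + m (F x) b) := by
  intro ℓ
  have hd : ∀ i j, MDifferentiableAt (𝓡 n) 𝓘(ℝ, ℝ) (fun y => (Module.finBasis ℝ W₁).coord i (F y) *
      (Module.finBasis ℝ W₂).coord j (G y)) x := fun i j => (hF _).1.mul (hG _).1
  have hd2 : ∀ i j, MDifferentiableAt (𝓡 n) 𝓘(ℝ, ℝ) (fun y => (Module.finBasis ℝ W₁).coord i (F y) *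
      (Module.finBasis ℝ W₂).coord j (G y) *
      ℓ (m (Module.finBasis ℝ W₁ i) (Module.finBasis ℝ W₂ j))) x :=
    fun i j => (hd i j).mul mdifferentiableAt_const
  have hd3 : ∀ i, MDifferentiableAt (𝓡 n) 𝓘(ℝ, ℝ) (fun y => ∑ j,
      (Module.finBasis ℝ W₁).coord i (F y) * (Module.finBasis ℝ W₂).coord j (G y) *
      ℓ (m (Module.finBasis ℝ W₁ i) (Module.finBasis ℝ W₂ j))) x :=
    fun i => mdifferentiableAt_sum _ fun j _ => hd2 i j
  have e : (fun y => ℓ (m (F y) (G y))) = _ := funext fun y => dual_bilin_eq_sum m ℓ (F y) (G y)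
  rw [e]
  constructor
  · exact mdifferentiableAt_sum _ fun i _ => hd3 i
  · rw [dFun_sum _ fun i _ => hd3 i, map_add, dual_bilin_eq_sum, dual_bilin_eq_sum,
      ← Finset.sum_add_distrib]
    refine Finset.sum_congr rfl fun i _ => ?_
    rw [dFun_sum _ fun j _ => hd2 i j, ← Finset.sum_add_distrib]
    refine Finset.sum_congr rfl fun j _ => ?_
    rw [dFun_mul (hd i j) mdifferentiableAt_const, dFun_mul (hF _).1 (hG _).1, (hF _).2, (hG _).2,
      dFun_const, LinearMap.zero_apply]
    ring

/-- Smoothness at a point of a map to a vector space, tested on linear functionals. -/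
def SmoothAt (n : ℕ) {M : Type*} [TopologicalSpace M] [ChartedSpace (Model n) M] (F : M → W)
    (x : M) : Prop :=
  ∀ ℓ : Module.Dual ℝ W, ContMDiffAt (𝓡 n) 𝓘(ℝ, ℝ) ∞ (fun y => ℓ (F y)) x

theorem SmoothAt.contMDiffAt {f : M → ℝ} {x : M} (h : SmoothAt n f x) :
    ContMDiffAt (𝓡 n) 𝓘(ℝ, ℝ) ∞ f x :=
  h LinearMap.id

theorem smoothAt_of_contMDiffAt {E : Type*} [NormedAddCommGroup E] [NormedSpace ℝ E]
    [FiniteDimensional ℝ E] {f : M → E} {x : M} (h : ContMDiffAt (𝓡 n) 𝓘(ℝ, E) ∞ f x) :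
    SmoothAt n f x := fun ℓ =>
  (LinearMap.toContinuousLinearMap ℓ).contMDiff.contMDiffAt.comp x h

theorem SmoothAt.congr {F G : M → W} {x : M} (h : SmoothAt n F x) (hFG : G =ᶠ[𝓝 x] F) :
    SmoothAt n G x :=
  fun ℓ => (h ℓ).congr_of_eventuallyEq (hFG.mono fun _ hy => congrArg ℓ hy)

theorem SmoothAt.linear {F : M → W} {x : M} (h : SmoothAt n F x) (L : W →ₗ[ℝ] W₁) :
    SmoothAt n (fun y => L (F y)) x :=
  fun ℓ => h (ℓ ∘ₗ L)

theorem SmoothAt.sum {κ : Type*} (s : Finset κ) {F : κ → M → W} {x : M}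
    (hF : ∀ i ∈ s, SmoothAt n (F i) x) : SmoothAt n (fun y => ∑ i ∈ s, F i y) x := by
  intro ℓ
  simp only [map_sum]
  exact contMDiffAt_finsetSum fun i hi => hF i hi ℓ

theorem SmoothAt.bilin [Module.Finite ℝ W₁] [Module.Finite ℝ W₂] {F : M → W₁} {G : M → W₂}
    {x : M} (hF : SmoothAt n F x) (hG : SmoothAt n G x) (m : W₁ →ₗ[ℝ] W₂ →ₗ[ℝ] W) :
    SmoothAt n (fun y => m (F y) (G y)) x := by
  intro ℓ
  have e : (fun y => ℓ (m (F y) (G y))) = _ := funext fun y => dual_bilin_eq_sum m ℓ (F y) (G y)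
  rw [e]
  exact contMDiffAt_finsetSum fun i _ => contMDiffAt_finsetSum fun j _ =>
    ((hF _).mul (hG _)).mul contMDiffAt_const

end Calculus

/-! ### Components of multivectors, vectors and `1`-forms in a chart. -/

section Coordinates

variable {n : ℕ} {M : Type*} [TopologicalSpace M] [ChartedSpace (Model n) M]

open Filter Topology

instance : Module.Finite ℝ (ExteriorAlgebra ℝ (Model n)) := Module.Finite.of_basis (extBasis n)

theorem chart_source_mem_nhds {x₀ y : M} (hy : y ∈ (chartAt (Model n) x₀).source) :
    (chartAt (Model n) x₀).source ∈ 𝓝 y :=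
  (chartAt (Model n) x₀).open_source.mem_nhds hy

theorem mdifferentiableAt_of_contMDiffAt {f : M → ℝ} {x : M}
    (h : ContMDiffAt (𝓡 n) 𝓘(ℝ, ℝ) ∞ f x) : MDifferentiableAt (𝓡 n) 𝓘(ℝ, ℝ) f x :=
  h.mdifferentiableAt (by simp)

variable [IsManifold (𝓡 n) ∞ M]

/-- The components of a tangent vector at `y` in the chart at `x₀`. -/
def toModel (x₀ y : M) : TangentSpace (𝓡 n) y →ₗ[ℝ] Model n :=
  ((trivializationAt (Model n) (TangentSpace (𝓡 n)) x₀).continuousLinearMapAt ℝ y :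
    TangentSpace (𝓡 n) y →L[ℝ] Model n)

/-- The tangent vector at `y` with given components in the chart at `x₀`. -/
def ofModel (x₀ y : M) : Model n →ₗ[ℝ] TangentSpace (𝓡 n) y :=
  ((trivializationAt (Model n) (TangentSpace (𝓡 n)) x₀).symmL ℝ y :
    Model n →L[ℝ] TangentSpace (𝓡 n) y)

theorem mem_baseSet {x₀ y : M} (hy : y ∈ (chartAt (Model n) x₀).source) :
    y ∈ (trivializationAt (Model n) (TangentSpace (𝓡 n)) x₀).baseSet := by
  rwa [TangentBundle.trivializationAt_baseSet]

theorem ofModel_comp_toModel {x₀ y : M} (hy : y ∈ (chartAt (Model n) x₀).source) :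
    ofModel (n := n) x₀ y ∘ₗ toModel x₀ y = LinearMap.id :=
  LinearMap.ext fun v => Bundle.Trivialization.symmL_continuousLinearMapAt _ (mem_baseSet hy) v

theorem toModel_comp_ofModel {x₀ y : M} (hy : y ∈ (chartAt (Model n) x₀).source) :
    toModel (n := n) x₀ y ∘ₗ ofModel x₀ y = LinearMap.id :=
  LinearMap.ext fun v => Bundle.Trivialization.continuousLinearMapAt_symmL _ (mem_baseSet hy) v

/-- The coordinate change from a chart to itself is the identity. This reconciles the definitions
that treat `T_x M` as `ℝⁿ` outright with components taken through the trivialization. -/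
theorem toModel_self (x : M) (v : TangentSpace (𝓡 n) x) : toModel x x v = (v : Model n) := by
  have h := TangentBundle.continuousLinearMapAt_trivializationAt_eq_core (I := 𝓡 n)
    (mem_chart_source (Model n) x)
  have h2 := (tangentBundleCore (𝓡 n) M).coordChange_self (achart (Model n) x) x
    (mem_achart_source (Model n) x) v
  exact (DFunLike.congr_fun h v).trans h2

/-- The components of a field of multivectors in the chart at `x₀`. -/
def coords (x₀ : M) (u : ∀ x : M, Fiber n x) (y : M) : ExteriorAlgebra ℝ (Model n) :=
  ExteriorAlgebra.map (toModel x₀ y) (u y)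

theorem map_ofModel_coords {x₀ y : M} (hy : y ∈ (chartAt (Model n) x₀).source)
    (u : ∀ x : M, Fiber n x) : ExteriorAlgebra.map (ofModel x₀ y) (coords x₀ u y) = u y := by
  have h := ExteriorAlgebra.map_comp_map (R := ℝ) (toModel x₀ y) (ofModel (n := n) x₀ y)
  rw [ofModel_comp_toModel hy, ExteriorAlgebra.map_id] at h
  exact DFunLike.congr_fun h (u y)

theorem dual_eq_sum (ℓ : Module.Dual ℝ (ExteriorAlgebra ℝ (Model n)))
    (w : ExteriorAlgebra ℝ (Model n)) :
    ℓ w = ∑ s, (extBasis n).coord s w * ℓ (extBasis n s) := by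
  conv_lhs => rw [← (extBasis n).sum_repr w]
  simp only [map_sum, map_smul, smul_eq_mul, Module.Basis.coord_apply]

theorem IsSmoothMV.smoothAt {u : ∀ x : M, Fiber n x} (hu : IsSmoothMV u) {x₀ y : M}
    (hy : y ∈ (chartAt (Model n) x₀).source) : SmoothAt n (coords x₀ u) y := by
  intro ℓ
  have e : (fun y => ℓ (coords x₀ u y)) = _ := funext fun y => dual_eq_sum ℓ (coords x₀ u y)
  rw [e]
  exact contMDiffAt_finsetSum fun s _ =>
    ((hu x₀ s).contMDiffAt (chart_source_mem_nhds hy)).mul contMDiffAt_const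

theorem isSmoothMV_of_smoothAt {u : ∀ x : M, Fiber n x}
    (h : ∀ x₀ y : M, y ∈ (chartAt (Model n) x₀).source → SmoothAt n (coords x₀ u) y) :
    IsSmoothMV u :=
  fun x₀ s y hy => (h x₀ y hy ((extBasis n).coord s)).contMDiffWithinAt

theorem coords_congr {x₀ y : M} {u v : ∀ x : M, Fiber n x} (h : ∀ᶠ z in 𝓝 y, u z = v z) :
    coords x₀ u =ᶠ[𝓝 y] coords x₀ v :=
  h.mono fun z hz => by rw [coords, coords, hz]

/-- Smoothness of a field of multivectors is a local property. -/
theorem isSmoothMV_of_locally {u : ∀ x : M, Fiber n x}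
    (h : ∀ y : M, ∃ v : ∀ x : M, Fiber n x, IsSmoothMV v ∧ ∀ᶠ z in 𝓝 y, u z = v z) :
    IsSmoothMV u :=
  isSmoothMV_of_smoothAt fun _ y hy =>
    let ⟨_, hv, hz⟩ := h y
    (hv.smoothAt hy).congr (coords_congr hz)

theorem map_toModel_self (x : M) (w : ExteriorAlgebra ℝ (Model n)) :
    ExteriorAlgebra.map (toModel x x) (w : Fiber n x) = w := by
  have h : (toModel x x : Model n →ₗ[ℝ] Model n) = LinearMap.id :=
    LinearMap.ext fun v => toModel_self x v
  have h2 : ∀ T : Model n →ₗ[ℝ] Model n, T = LinearMap.id → ExteriorAlgebra.map T w = w := by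
    rintro _ rfl
    rw [ExteriorAlgebra.map_id, AlgHom.id_apply]
  exact h2 _ h

/-- The chart derivative of a field of multivectors is the derivative of its components. -/
theorem IsSmoothMV.hasDerivAlong {u : ∀ x : M, Fiber n x} (hu : IsSmoothMV u) (x : M)
    (v : TangentSpace (𝓡 n) x) :
    HasDerivAlong (coords x u) x v (ExteriorAlgebra.map (toModel x x) (chartDeriv u x v)) := by
  have h1 : ExteriorAlgebra.map (toModel x x) (chartDeriv u x v) =
      ∑ s : Finset (Fin n), dFun (coeff x s u) x v • extBasis n s := map_toModel_self x _
  intro ℓ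
  have hd := (hu.smoothAt (mem_chart_source (Model n) x))
  refine ⟨mdifferentiableAt_of_contMDiffAt (hd ℓ), ?_⟩
  have e : (fun y => ℓ (coords x u y)) = _ := funext fun y => dual_eq_sum ℓ (coords x u y)
  have hds : ∀ s, MDifferentiableAt (𝓡 n) 𝓘(ℝ, ℝ)
      (fun y => (extBasis n).coord s (coords x u y)) x :=
    fun s => mdifferentiableAt_of_contMDiffAt (hd _)
  have hds2 : ∀ s, MDifferentiableAt (𝓡 n) 𝓘(ℝ, ℝ)
      (fun y => (extBasis n).coord s (coords x u y) * ℓ (extBasis n s)) x :=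
    fun s => (hds s).mul mdifferentiableAt_const
  rw [h1, e, dFun_sum _ fun s _ => hds2 s, map_sum]
  refine Finset.sum_congr rfl fun s _ => ?_
  rw [dFun_mul (hds s) mdifferentiableAt_const, dFun_const, LinearMap.zero_apply, mul_zero,
    add_zero, map_smul, smul_eq_mul]
  rfl

theorem coords_vec (X : VecField n M) (x₀ y : M) :
    coords x₀ (ofVec X).1 y = ExteriorAlgebra.ι ℝ (toModel x₀ y (X y)) :=
  ExteriorAlgebra.map_apply_ι _ _

theorem smoothAt_vec (X : VecField n M) {x₀ y : M} (hy : y ∈ (chartAt (Model n) x₀).source) :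
    SmoothAt n (fun z => toModel x₀ z (X z)) y := by
  have h := ((IsSmoothMV.of_vec X).smoothAt hy).linear ExteriorAlgebra.ιInv
  refine h.congr (Eventually.of_forall fun z => ?_)
  exact ((congrArg _ (coords_vec X x₀ z)).trans (ExteriorAlgebra.ι_leftInverse _)).symm

/-- The components of a `1`-form in the chart at `x₀`. -/
def OneForm.coords (ξ : OneForm n M) (x₀ y : M) : Module.Dual ℝ (Model n) :=
  ξ.at y ∘ₗ ofModel x₀ y

theorem OneForm.at_eq_coords (ξ : OneForm n M) {x₀ y : M}
    (hy : y ∈ (chartAt (Model n) x₀).source) : ξ.at y = ξ.coords x₀ y ∘ₗ toModel x₀ y := by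
  rw [OneForm.coords, LinearMap.comp_assoc, ofModel_comp_toModel hy, LinearMap.comp_id]

theorem OneForm.contMDiffAt_coords (ξ : OneForm n M) {x₀ y : M}
    (hy : y ∈ (chartAt (Model n) x₀).source) :
    ContMDiffAt (𝓡 n) 𝓘(ℝ, Model n →L[ℝ] ℝ) ∞
      (fun z : M => ((ξ z : TangentSpace (𝓡 n) z →L[ℝ] ℝ) ∘L
        (trivializationAt (Model n) (TangentSpace (𝓡 n)) x₀).symmL ℝ z : Model n →L[ℝ] ℝ)) y := by
  set e := trivializationAt (Model n →L[ℝ] ℝ)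
    (fun x : M => TangentSpace (𝓡 n) x →L[ℝ] Bundle.Trivial M ℝ x) x₀ with he
  have h := (e.contMDiffOn_section_baseSet_iff (IB := 𝓡 n) (n := ∞) (s := fun x => ξ x)).1
    ξ.contMDiff.contMDiffOn
  have hb : y ∈ e.baseSet := by
    rw [he, hom_trivializationAt_baseSet]
    exact ⟨mem_baseSet hy, trivial⟩
  refine (h.contMDiffAt (e.open_baseSet.mem_nhds hb)).congr_of_eventuallyEq ?_
  filter_upwards with z
  rw [he, hom_trivializationAt_apply]
  ext v
  simp [ContinuousLinearMap.inCoordinates]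

theorem OneForm.smoothAt_coords (ξ : OneForm n M) {x₀ y : M}
    (hy : y ∈ (chartAt (Model n) x₀).source) : SmoothAt n (ξ.coords x₀) y :=
  (smoothAt_of_contMDiffAt (ξ.contMDiffAt_coords hy)).linear (ContinuousLinearMap.coeLM ℝ)

theorem OneForm.hasDerivAlong_coords (ξ : OneForm n M) (x : M) (v : TangentSpace (𝓡 n) x) :
    HasDerivAlong (ξ.coords x) x v
      (ContinuousLinearMap.coeLM ℝ (ξ.chartDeriv x (toModel x x v))) := by
  have h := (ξ.contMDiffAt_coords (mem_chart_source (Model n) x)).mdifferentiableAt (by simp)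
  intro ℓ
  let L : (Model n →L[ℝ] ℝ) →L[ℝ] ℝ :=
    LinearMap.toContinuousLinearMap (ℓ ∘ₗ ContinuousLinearMap.coeLM ℝ)
  have h2 := L.hasMFDerivAt.comp x h.hasMFDerivAt
  refine ⟨h2.mdifferentiableAt, ?_⟩
  refine (dFun_eq_of_hasMFDerivAt h2 v).trans ?_
  rw [toModel_self]
  rfl

end Coordinates

/-! ### Three-forms as trilinear maps. -/

section Trilinear

variable {V : Type*} [AddCommGroup V] [Module ℝ V]

/-- An alternating `3`-form as a trilinear map. -/
def trilin : (V [⋀^Fin 3]→ₗ[ℝ] ℝ) →ₗ[ℝ] V →ₗ[ℝ] V →ₗ[ℝ] V →ₗ[ℝ] ℝ :=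
  let l₀ : (V [⋀^Fin 0]→ₗ[ℝ] ℝ) →ₗ[ℝ] ℝ :=
    AlternatingMap.constLinearEquivOfIsEmpty.symm.toLinearMap
  let l₁ : (V [⋀^Fin 1]→ₗ[ℝ] ℝ) →ₗ[ℝ] V →ₗ[ℝ] ℝ :=
    LinearMap.compRight ℝ l₀ ∘ₗ AlternatingMap.curryLeftLinearMap
  let l₂ : (V [⋀^Fin 2]→ₗ[ℝ] ℝ) →ₗ[ℝ] V →ₗ[ℝ] V →ₗ[ℝ] ℝ :=
    LinearMap.compRight ℝ l₁ ∘ₗ AlternatingMap.curryLeftLinearMap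
  LinearMap.compRight ℝ l₂ ∘ₗ AlternatingMap.curryLeftLinearMap

theorem trilin_apply (ψ : V [⋀^Fin 3]→ₗ[ℝ] ℝ) (a b c : V) : trilin ψ a b c = ψ ![a, b, c] := by
  change ψ (Matrix.vecCons a (Matrix.vecCons b (Matrix.vecCons c 0))) = _
  congr 1
  ext i
  fin_cases i <;> rfl

/-- With `i_{v∧w} = i_v ∘ i_w` the vector `w` is inserted first; one transposition restores the
order. This sign cancels the minus in front of the bracket in the formula for the derivation. -/
theorem contrForm₂_eq_neg_trilin (v w z : V) (ψ : V [⋀^Fin 3]→ₗ[ℝ] ℝ) :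
    contrForm₂ v w ψ z = -trilin ψ v w z := by
  rw [contrForm₂_apply, trilin_apply]
  have h := ψ.map_swap ![v, w, z] (i := 0) (j := 1) (by decide)
  rw [← h]
  congr 1
  ext i
  fin_cases i <;> rfl

end Trilinear

/-! ### Componentwise differentiation in the chart at a point, and its product rules. -/

section Derivative

variable {n : ℕ} {M : Type*} [TopologicalSpace M] [ChartedSpace (Model n) M]

open Filter Topology

theorem HasDerivAlong.add {W : Type*} [AddCommGroup W] [Module ℝ W] {F G : M → W} {x : M}
    {v : TangentSpace (𝓡 n) x} {a b : W} (hF : HasDerivAlong F x v a)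
    (hG : HasDerivAlong G x v b) : HasDerivAlong (fun y => F y + G y) x v (a + b) := by
  intro ℓ
  simp only [map_add]
  exact ⟨(hF ℓ).1.add (hG ℓ).1, by rw [dFun_add (hF ℓ).1 (hG ℓ).1, (hF ℓ).2, (hG ℓ).2]⟩

/-- If `a` were outside `S`, some functional vanishing on `S` would be nonzero at `a`, although its
composite with `F` is identically zero. Applied to the graded pieces, this shows that
differentiation preserves degree. -/
theorem HasDerivAlong.mem {W : Type*} [AddCommGroup W] [Module ℝ W] {F : M → W} {x : M}
    {v : TangentSpace (𝓡 n) x} {a : W} (hF : HasDerivAlong F x v a) {S : Submodule ℝ W}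
    (hS : ∀ y, F y ∈ S) : a ∈ S := by
  by_contra ha
  obtain ⟨ℓ, hℓ, hle⟩ := Submodule.exists_le_ker_of_notMem ha
  refine hℓ ?_
  have e : (fun y => ℓ (F y)) = fun _ => 0 := funext fun y => hle (hS y)
  rw [← (hF ℓ).2, e, dFun_const, LinearMap.zero_apply]

/-- The basis of `T_x M` given by the chart at `x`. -/
def tangentBasis (x : M) : Module.Basis (Fin n) ℝ (TangentSpace (𝓡 n) x) :=
  ((EuclideanSpace.basisFun (Fin n) ℝ).toBasis : Module.Basis (Fin n) ℝ (Model n))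

theorem tangentBasis_apply (x : M) (i : Fin n) : tangentBasis x i = coordVec x i := by
  have h : (EuclideanSpace.basisFun (Fin n) ℝ).toBasis i = EuclideanSpace.single i (1 : ℝ) := by
    rw [OrthonormalBasis.coe_toBasis, EuclideanSpace.basisFun_apply]
  exact h

theorem tangentBasis_coord (x : M) (i : Fin n) : (tangentBasis x).coord i = coordCovec x i := by
  refine LinearMap.ext fun v => ?_
  have h : ∀ v : Model n, (EuclideanSpace.basisFun (Fin n) ℝ).toBasis.repr v i = v i := by
    intro v
    simp
  exact h v

theorem sum_coordCovec_smul (x : M) (v : TangentSpace (𝓡 n) x) :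
    ∑ i, coordCovec x i v • coordVec x i = v := by
  have h := (tangentBasis x).sum_repr v
  simpa only [← tangentBasis_coord, ← tangentBasis_apply, Module.Basis.coord_apply] using h

theorem sum_smul_coordCovec (x : M) (ξ : Module.Dual ℝ (TangentSpace (𝓡 n) x)) :
    ∑ i, ξ (coordVec x i) • coordCovec x i = ξ := by
  refine LinearMap.ext fun v => ?_
  conv_rhs => rw [← sum_coordCovec_smul x v]
  simp only [LinearMap.sum_apply, LinearMap.smul_apply, map_sum, map_smul, smul_eq_mul, mul_comm]

variable [IsManifold (𝓡 n) ∞ M]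

theorem map_toModel_injective (x : M) :
    Function.Injective (ExteriorAlgebra.map (R := ℝ) (toModel (n := n) x x)) := by
  have h := ExteriorAlgebra.map_comp_map (R := ℝ) (toModel x x) (ofModel (n := n) x x)
  rw [ofModel_comp_toModel (mem_chart_source (Model n) x), ExteriorAlgebra.map_id] at h
  exact Function.LeftInverse.injective (g := ExteriorAlgebra.map (ofModel x x))
    (DFunLike.congr_fun h)

/-- Taking components at `x` is injective, so `chartDeriv` can be computed by exhibiting any
derivative of the components; the rules below all come from this. -/
theorem chartDeriv_unique {u : ∀ x : M, Fiber n x} (hu : IsSmoothMV u) {x : M}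
    {v : TangentSpace (𝓡 n) x} {a : Fiber n x}
    (h : HasDerivAlong (coords x u) x v (ExteriorAlgebra.map (toModel x x) a)) :
    chartDeriv u x v = a :=
  map_toModel_injective x ((hu.hasDerivAlong x v).unique h)

theorem chartDeriv_congr {u v : ∀ x : M, Fiber n x} {x : M} (h : ∀ᶠ y in 𝓝 x, u y = v y)
    (w : TangentSpace (𝓡 n) x) : chartDeriv u x w = chartDeriv v x w := by
  have h2 : ∀ s, dFun (coeff x s u) x w = dFun (coeff x s v) x w := by
    intro s
    rw [dFun_congr (f := coeff x s u) (g := coeff x s v)]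
    exact (coords_congr (x₀ := x) h).mono fun y hy => congrArg ((extBasis n).coord s) hy
  simp only [chartDeriv, h2]
  rfl

theorem chartDeriv_mul {u v : ∀ x : M, Fiber n x} (hu : IsSmoothMV u) (hv : IsSmoothMV v) (x : M)
    (w : TangentSpace (𝓡 n) x) :
    chartDeriv (u * v) x w = chartDeriv u x w * v x + u x * chartDeriv v x w := by
  refine chartDeriv_unique ((MultiVec n M).mul_mem hu hv) ?_
  have h := (hu.hasDerivAlong x w).bilin (hv.hasDerivAlong x w)
    (LinearMap.mul ℝ (ExteriorAlgebra ℝ (Model n)))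
  simp only [LinearMap.mul_apply'] at h
  rw [map_add, map_mul, map_mul]
  refine h.congr (Eventually.of_forall fun y => ?_)
  simp only [coords, Pi.mul_apply, map_mul]

theorem chartDeriv_add {u v : ∀ x : M, Fiber n x} (hu : IsSmoothMV u) (hv : IsSmoothMV v) (x : M)
    (w : TangentSpace (𝓡 n) x) :
    chartDeriv (u + v) x w = chartDeriv u x w + chartDeriv v x w := by
  refine chartDeriv_unique ((MultiVec n M).add_mem hu hv) ?_
  rw [map_add]
  refine ((hu.hasDerivAlong x w).add (hv.hasDerivAlong x w)).congr
    (Eventually.of_forall fun y => ?_)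
  simp only [coords, Pi.add_apply, map_add]

theorem chartDeriv_smul (r : ℝ) {u : ∀ x : M, Fiber n x} (hu : IsSmoothMV u) (x : M)
    (w : TangentSpace (𝓡 n) x) : chartDeriv (r • u) x w = r • chartDeriv u x w := by
  refine chartDeriv_unique ((MultiVec n M).smul_mem hu r) ?_
  rw [map_smul]
  refine ((hu.hasDerivAlong x w).linear (r • LinearMap.id)).congr
    (Eventually.of_forall fun y => ?_)
  simp only [coords, Pi.smul_apply, map_smul, LinearMap.smul_apply, LinearMap.id_apply]

theorem chartDeriv_fun (f : C^∞⟮𝓡 n, M; ℝ⟯) (x : M) (w : TangentSpace (𝓡 n) x) :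
    chartDeriv (ofFun f).1 x w = algebraMap ℝ (Fiber n x) (dFun f x w) := by
  refine chartDeriv_unique (ofFun f).2 ?_
  rw [AlgHom.commutes]
  refine ((hasDerivAlong_dFun (mdifferentiableAt_of_contMDiffAt f.contMDiff.contMDiffAt) w).linear
    (Algebra.linearMap ℝ (ExteriorAlgebra ℝ (Model n)))).congr (Eventually.of_forall fun y => ?_)
  exact AlgHom.commutes _ _

theorem chartDeriv_eq_sum (u : ∀ x : M, Fiber n x) (x : M) (w : TangentSpace (𝓡 n) x) :
    chartDeriv u x w = ∑ i, coordCovec x i w • chartDeriv u x (coordVec x i) := by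
  let L : TangentSpace (𝓡 n) x →ₗ[ℝ] ExteriorAlgebra ℝ (Model n) :=
    ∑ s : Finset (Fin n), (dFun (coeff x s u) x).smulRight (extBasis n s)
  have hL : ∀ w, chartDeriv u x w = L w := fun w => by
    simp only [L, LinearMap.sum_apply, LinearMap.smulRight_apply]
    rfl
  have h : L w = ∑ i, coordCovec x i w • L (coordVec x i) := by
    conv_lhs => rw [← sum_coordCovec_smul x w]
    simp only [map_sum, map_smul]
  rw [hL, h]
  simp only [hL]
  rfl

theorem chartDeriv_mem {u : ∀ x : M, Fiber n x} (hu : IsSmoothMV u) {k : ℕ}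
    (hk : ∀ x, u x ∈ ⋀[ℝ]^k (TangentSpace (𝓡 n) x)) (x : M) (w : TangentSpace (𝓡 n) x) :
    chartDeriv u x w ∈ ⋀[ℝ]^k (TangentSpace (𝓡 n) x) := by
  have h := (hu.hasDerivAlong x w).mem (S := ⋀[ℝ]^k (Model n))
    fun y => map_mem_exteriorPower _ k (hk y)
  have h2 := map_mem_exteriorPower (ofModel x x) k h
  have h3 := ExteriorAlgebra.map_comp_map (R := ℝ) (toModel x x) (ofModel (n := n) x x)
  rw [ofModel_comp_toModel (mem_chart_source (Model n) x), ExteriorAlgebra.map_id] at h3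
  have h4 := DFunLike.congr_fun h3 (chartDeriv u x w)
  rw [AlgHom.comp_apply, AlgHom.id_apply] at h4
  rwa [h4] at h2

/-- The derivative at `x` of a vector field, component by component in the chart at `x`. -/
def vecDeriv (X : VecField n M) (x : M) (w : TangentSpace (𝓡 n) x) : TangentSpace (𝓡 n) x :=
  ExteriorAlgebra.ιInv (chartDeriv (ofVec X).1 x w)

theorem chartDeriv_vec (X : VecField n M) (x : M) (w : TangentSpace (𝓡 n) x) :
    chartDeriv (ofVec X).1 x w = ExteriorAlgebra.ι ℝ (vecDeriv X x w) := by
  obtain ⟨v, hv⟩ := mem_exteriorPower_one.1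
    (chartDeriv_mem (ofVec X).2 (k := 1) (fun y => mem_exteriorPower_one.2 ⟨X y, rfl⟩) x w)
  rw [vecDeriv, ← hv, ExteriorAlgebra.ι_leftInverse]

theorem vecDeriv_eq_sum (X : VecField n M) (x : M) (w : TangentSpace (𝓡 n) x) :
    vecDeriv X x w = ∑ i, coordCovec x i w • vecDeriv X x (coordVec x i) := by
  rw [vecDeriv, chartDeriv_eq_sum]
  simp only [map_sum, map_smul, vecDeriv]

theorem hasDerivAlong_vec (X : VecField n M) (x : M) (w : TangentSpace (𝓡 n) x) :
    HasDerivAlong (fun y => toModel x y (X y)) x w (toModel x x (vecDeriv X x w)) := by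
  have h := ((IsSmoothMV.of_vec X).hasDerivAlong x w).linear ExteriorAlgebra.ιInv
  have e : ExteriorAlgebra.ιInv (ExteriorAlgebra.map (toModel x x) (chartDeriv (ofVec X).1 x w)) =
      toModel x x (vecDeriv X x w) := by
    rw [chartDeriv_vec, ExteriorAlgebra.map_apply_ι, ExteriorAlgebra.ι_leftInverse]
  rw [← e]
  refine h.congr (Eventually.of_forall fun z => ?_)
  exact ((congrArg _ (coords_vec X x z)).trans (ExteriorAlgebra.ι_leftInverse _)).symm

/-- The derivative at `x` of a `1`-form along a vector, as a covector. -/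
def OneForm.derivAlong (ξ : OneForm n M) (x : M) (w : TangentSpace (𝓡 n) x) :
    Module.Dual ℝ (TangentSpace (𝓡 n) x) :=
  (ContinuousLinearMap.coeLM ℝ (ξ.chartDeriv x (toModel x x w)) : Model n →ₗ[ℝ] ℝ) ∘ₗ toModel x x

theorem OneForm.d_apply (ξ : OneForm n M) (x : M) (v w : TangentSpace (𝓡 n) x) :
    ξ.d x v w = ξ.derivAlong x v w - ξ.derivAlong x w v := by
  simp only [OneForm.derivAlong, LinearMap.comp_apply, toModel_self]
  rfl

theorem OneForm.coords_self_comp (ξ : OneForm n M) (x : M) :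
    ξ.coords x x ∘ₗ toModel x x = ξ.at x :=
  (ξ.at_eq_coords (mem_chart_source (Model n) x)).symm

theorem dFun_pairing (ξ : OneForm n M) (X : VecField n M) (x : M) (w : TangentSpace (𝓡 n) x) :
    dFun (fun y => ξ.at y (X y)) x w = ξ.derivAlong x w (X x) + ξ.at x (vecDeriv X x w) := by
  have h := (ξ.hasDerivAlong_coords x w).bilin (hasDerivAlong_vec X x w) LinearMap.id
  -- The pairing equals the pairing of components only where the chart is defined, which suffices
  -- for a derivative at `x`.
  have h2 : HasDerivAlong (fun y => ξ.at y (X y)) x w _ := h.congr (by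
    filter_upwards [chart_source_mem_nhds (mem_chart_source (Model n) x)] with y hy
    rw [ξ.at_eq_coords hy]
    rfl)
  rw [h2.dFun_eq, ← ξ.coords_self_comp]
  rfl

/-- The contraction as a bilinear map. -/
def contrₗ {V : Type*} [AddCommGroup V] [Module ℝ V] :
    Module.Dual ℝ V →ₗ[ℝ] ExteriorAlgebra ℝ V →ₗ[ℝ] ExteriorAlgebra ℝ V :=
  CliffordAlgebra.contractLeft

theorem contrₗ_apply {V : Type*} [AddCommGroup V] [Module ℝ V] (ξ : Module.Dual ℝ V)
    (u : ExteriorAlgebra ℝ V) : contrₗ ξ u = contr ξ u :=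
  rfl

theorem coords_contr (u : ∀ x : M, Fiber n x) (ξ : OneForm n M) {x₀ y : M}
    (hy : y ∈ (chartAt (Model n) x₀).source) :
    coords x₀ (fun z => contr (ξ.at z) (u z)) y = contr (ξ.coords x₀ y) (coords x₀ u y) := by
  rw [coords, coords, contr_map, ← ξ.at_eq_coords hy]

theorem eval₂_eq_coords (u : ∀ x : M, Fiber n x) (ξ η : OneForm n M) {x₀ y : M}
    (hy : y ∈ (chartAt (Model n) x₀).source) :
    eval₂ (u y) (ξ.at y) (η.at y) = eval₂ (coords x₀ u y) (ξ.coords x₀ y) (η.coords x₀ y) := by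
  rw [coords, eval₂_map, ← ξ.at_eq_coords hy, ← η.at_eq_coords hy]

/-- The value is trilinear in the components of `u`, `ξ` and `η`, so the bilinear product rule is
applied twice. -/
theorem dFun_eval₂ {u : ∀ x : M, Fiber n x} (hu : IsSmoothMV u) (ξ η : OneForm n M) (x : M)
    (w : TangentSpace (𝓡 n) x) :
    dFun (fun y => eval₂ (u y) (ξ.at y) (η.at y)) x w =
      eval₂ (chartDeriv u x w) (ξ.at x) (η.at x) + eval₂ (u x) (ξ.derivAlong x w) (η.at x)
        + eval₂ (u x) (ξ.at x) (η.derivAlong x w) := by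
  have h := ((η.hasDerivAlong_coords x w).bilin ((ξ.hasDerivAlong_coords x w).bilin
    (hu.hasDerivAlong x w) contrₗ) contrₗ).linear ExteriorAlgebra.algebraMapInv.toLinearMap
  have h2 : HasDerivAlong (fun y => eval₂ (u y) (ξ.at y) (η.at y)) x w _ := h.congr (by
    filter_upwards [chart_source_mem_nhds (mem_chart_source (Model n) x)] with y hy
    rw [eval₂_eq_coords u ξ η hy]
    rfl)
  rw [h2.dFun_eq]
  simp only [map_add, AlgHom.toLinearMap_apply, contrₗ_apply]
  rw [← ξ.coords_self_comp, ← η.coords_self_comp, OneForm.derivAlong, OneForm.derivAlong,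
    ← eval₂_map, ← eval₂_map, ← eval₂_map]
  simp only [eval₂, coords]
  ring

end Derivative

/-! ### The twisted operator: Leibniz rule, and values on functions and vector fields. -/

section Operator

variable {n : ℕ} {M : Type*} [TopologicalSpace M] [ChartedSpace (Model n) M]

open Filter Topology

theorem contr_eq_ι_sharp {P : ∀ x : M, Fiber n x} {x : M}
    (hP : P x ∈ ⋀[ℝ]^2 (TangentSpace (𝓡 n) x)) (ξ : Module.Dual ℝ (TangentSpace (𝓡 n) x)) :
    contr ξ (P x) = ExteriorAlgebra.ι ℝ (sharp P x ξ) :=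
  contr_eq_ι_ιInv hP ξ

theorem eval₂_eq_sharp {P : ∀ x : M, Fiber n x} {x : M}
    (hP : P x ∈ ⋀[ℝ]^2 (TangentSpace (𝓡 n) x)) (ξ η : Module.Dual ℝ (TangentSpace (𝓡 n) x)) :
    eval₂ (P x) ξ η = η (sharp P x ξ) :=
  eval₂_eq_of_mem_two hP ξ η

theorem apply_sharp_swap {P : ∀ x : M, Fiber n x} {x : M}
    (hP : P x ∈ ⋀[ℝ]^2 (TangentSpace (𝓡 n) x)) (ξ η : Module.Dual ℝ (TangentSpace (𝓡 n) x)) :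
    η (sharp P x ξ) = -ξ (sharp P x η) := by
  rw [← eval₂_eq_sharp hP, eval₂_swap, eval₂_eq_sharp hP]

theorem sharp_eq_sum (P : ∀ x : M, Fiber n x) (x : M)
    (ξ : Module.Dual ℝ (TangentSpace (𝓡 n) x)) :
    sharp P x ξ = ∑ i, ξ (coordVec x i) • sharp P x (coordCovec x i) := by
  have h : sharp P x ξ = ExteriorAlgebra.ιInv (contrₗ ξ (P x)) := rfl
  rw [h]
  conv_lhs => rw [← sum_smul_coordCovec x ξ]
  simp only [map_sum, map_smul, LinearMap.sum_apply, LinearMap.smul_apply]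
  rfl

theorem sum_mul_coordCovec (x : M) (ξ : Module.Dual ℝ (TangentSpace (𝓡 n) x))
    (v : TangentSpace (𝓡 n) x) : ∑ i, coordCovec x i v * ξ (coordVec x i) = ξ v := by
  conv_rhs => rw [← sum_coordCovec_smul x v]
  simp only [map_sum, map_smul, smul_eq_mul]

variable [IsManifold (𝓡 n) ∞ M]

theorem sharpSq_mem (P : ∀ x : M, Fiber n x) (ψ : DiffForm n M 3) (x : M)
    (v : TangentSpace (𝓡 n) x) : sharpSq P ψ x v ∈ ⋀[ℝ]^2 (TangentSpace (𝓡 n) x) :=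
  Submodule.smul_mem _ _ (Submodule.sum_mem _ fun _ _ => Submodule.sum_mem _ fun _ _ =>
    Submodule.smul_mem _ _ (ι_mul_ι_mem _ _))

theorem trilin_sharp_eq_sum (P : ∀ x : M, Fiber n x) (ψ : DiffForm n M 3) (x : M)
    (ξ η : Module.Dual ℝ (TangentSpace (𝓡 n) x)) (v : TangentSpace (𝓡 n) x) :
    trilin (ψ.at x) (sharp P x ξ) (sharp P x η) v = ∑ i, ∑ j, trilin (ψ.at x)
      (sharp P x (coordCovec x i)) (sharp P x (coordCovec x j)) v *
        (ξ (coordVec x i) * η (coordVec x j)) := by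
  conv_lhs => rw [sharp_eq_sum P x ξ, sharp_eq_sum P x η]
  simp only [map_sum, map_smul, LinearMap.sum_apply, LinearMap.smul_apply, smul_eq_mul,
    Finset.mul_sum]
  rw [Finset.sum_comm]
  refine Finset.sum_congr rfl fun i _ => Finset.sum_congr rfl fun j _ => ?_
  ring

/-- Each `eᵢ ∧ eⱼ` contributes two terms, which sum to equal amounts because `ψ` is alternating; the
factor one half in the definition absorbs the repetition. -/
theorem eval₂_sharpSq (P : ∀ x : M, Fiber n x) (ψ : DiffForm n M 3) (x : M)
    (v : TangentSpace (𝓡 n) x) (ξ η : Module.Dual ℝ (TangentSpace (𝓡 n) x)) :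
    eval₂ (sharpSq P ψ x v) ξ η = trilin (ψ.at x) (sharp P x ξ) (sharp P x η) v := by
  have hskew : trilin (ψ.at x) (sharp P x η) (sharp P x ξ) v =
      -trilin (ψ.at x) (sharp P x ξ) (sharp P x η) v := by
    rw [trilin_apply, trilin_apply]
    have h := (ψ.at x).map_swap ![sharp P x ξ, sharp P x η, v] (i := 0) (j := 1) (by decide)
    rw [← h]
    congr 1
    ext i
    fin_cases i <;> rfl
  simp only [sharpSq, eval₂_smul, eval₂_sum, eval₂_ι_mul_ι, ← trilin_apply, mul_sub,
    Finset.sum_sub_distrib]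
  rw [← trilin_sharp_eq_sum, ← trilin_sharp_eq_sum, hskew]
  ring

theorem sharpSq_eq_sum (P : ∀ x : M, Fiber n x) (ψ : DiffForm n M 3) (x : M)
    (v : TangentSpace (𝓡 n) x) :
    sharpSq P ψ x v = ∑ i, coordCovec x i v • sharpSq P ψ x (coordVec x i) := by
  refine ext_of_mem_two (tangentBasis x) (sharpSq_mem P ψ x v)
    (Submodule.sum_mem _ fun i _ => Submodule.smul_mem _ _ (sharpSq_mem P ψ x _)) fun ξ η => ?_
  simp only [eval₂_sum, eval₂_smul, eval₂_sharpSq, sum_mul_coordCovec]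

/-- The operator `[P, ·]_{SN} + i_{(⋀²P^♯)(ψ)}` on fields of multivectors. -/
def twistedOp (P : ∀ x : M, Fiber n x) (ψ : DiffForm n M 3) (u : ∀ x : M, Fiber n x) (x : M) :
    Fiber n x :=
  schouten P u x + interior (sharpSq P ψ) u x

theorem twistedOp_congr (P : ∀ x : M, Fiber n x) (ψ : DiffForm n M 3) {u v : ∀ x : M, Fiber n x}
    {x : M} (h : ∀ᶠ y in 𝓝 x, u y = v y) : twistedOp P ψ u x = twistedOp P ψ v x := by
  simp only [twistedOp, schouten, interior, h.self_of_nhds, chartDeriv_congr h]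

variable {P : ∀ x : M, Fiber n x}

theorem twistedOp_add (ψ : DiffForm n M 3) {u v : ∀ x : M, Fiber n x} (hu : IsSmoothMV u)
    (hv : IsSmoothMV v) (x : M) :
    twistedOp P ψ (u + v) x = twistedOp P ψ u x + twistedOp P ψ v x := by
  simp only [twistedOp, schouten, interior, chartDeriv_add hu hv, Pi.add_apply, map_add, mul_add,
    Finset.sum_sub_distrib, Finset.sum_add_distrib]
  abel

theorem twistedOp_smul (ψ : DiffForm n M 3) (r : ℝ) {u : ∀ x : M, Fiber n x} (hu : IsSmoothMV u)
    (x : M) : twistedOp P ψ (r • u) x = r • twistedOp P ψ u x := by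
  simp only [twistedOp, schouten, interior, chartDeriv_smul r hu, Pi.smul_apply, map_smul,
    mul_smul_comm, Finset.sum_sub_distrib, ← Finset.smul_sum, smul_add, smul_sub]

theorem schouten_eq (hP : ∀ x, P x ∈ ⋀[ℝ]^2 (TangentSpace (𝓡 n) x)) (u : ∀ x : M, Fiber n x)
    (x : M) : schouten P u x = ∑ i, (-(ExteriorAlgebra.ι ℝ (sharp P x (coordCovec x i)) *
      chartDeriv u x (coordVec x i)) - chartDeriv P x (coordVec x i) *
        contr (coordCovec x i) (u x)) := by
  simp only [schouten, contr_eq_ι_sharp (hP x), involute_ι', neg_mul]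

/-- The identity holds for each index `i` separately. Passing the vector `P^♯dxⁱ` across `u`
produces the involution of `u`; the antiderivation rule produces the same involution in the
contraction terms, across which the bivectors `∂ᵢP` and `B(eᵢ)` move without sign. -/
theorem twistedOp_mul (hPs : IsSmoothMV P) (hP : ∀ x, P x ∈ ⋀[ℝ]^2 (TangentSpace (𝓡 n) x))
    (ψ : DiffForm n M 3) {u v : ∀ x : M, Fiber n x} (hu : IsSmoothMV u) (hv : IsSmoothMV v)
    (x : M) : twistedOp P ψ (u * v) x =
      twistedOp P ψ u x * v x + CliffordAlgebra.involute (u x) * twistedOp P ψ v x := by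
  simp only [twistedOp, schouten_eq hP, interior, ← Finset.sum_add_distrib, Finset.sum_mul,
    Finset.mul_sum]
  refine Finset.sum_congr rfl fun i _ => ?_
  have h1 := ι_mul_comm' (sharp P x (coordCovec x i)) (u x)
  have h2 := commute_of_mem_two (chartDeriv_mem hPs hP x (coordVec x i))
    (CliffordAlgebra.involute (u x))
  have h3 := commute_of_mem_two (sharpSq_mem P ψ x (coordVec x i))
    (CliffordAlgebra.involute (u x))
  rw [Pi.mul_apply, chartDeriv_mul hu hv, contr_mul, mul_add, mul_add, mul_add,
    ← mul_assoc _ (u x) (chartDeriv v x _), h1, ← mul_assoc _ (CliffordAlgebra.involute (u x)), h2,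
    ← mul_assoc (sharpSq P ψ x _) (CliffordAlgebra.involute (u x)), h3]
  noncomm_ring

/-- Contractions kill functions, so neither `∂ᵢP` nor `ψ` contributes. The minus sign disappears on
evaluation, by skew-symmetry of `P`. -/
theorem twistedOp_fun (hP : ∀ x, P x ∈ ⋀[ℝ]^2 (TangentSpace (𝓡 n) x)) (ψ : DiffForm n M 3)
    (f : C^∞⟮𝓡 n, M; ℝ⟯) (x : M) :
    twistedOp P ψ (ofFun f).1 x = -ExteriorAlgebra.ι ℝ (sharp P x (dFun f x)) := by
  have h : ∀ i, contr (coordCovec x i) ((ofFun f).1 x) = 0 := fun i => contr_algebraMap _ _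
  simp only [twistedOp, schouten_eq hP, interior, h, mul_zero, Finset.sum_const_zero, add_zero,
    sub_zero, chartDeriv_fun, ← Algebra.commutes, ← Algebra.smul_def, Finset.sum_neg_distrib]
  rw [sharp_eq_sum P x (dFun f x)]
  simp only [map_sum, map_smul]

theorem twistedOp_fun_mem (hP : ∀ x, P x ∈ ⋀[ℝ]^2 (TangentSpace (𝓡 n) x)) (ψ : DiffForm n M 3)
    (f : C^∞⟮𝓡 n, M; ℝ⟯) (x : M) :
    twistedOp P ψ (ofFun f).1 x ∈ ⋀[ℝ]^1 (TangentSpace (𝓡 n) x) := by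
  rw [twistedOp_fun hP]
  exact mem_exteriorPower_one.2 ⟨-sharp P x (dFun f x), map_neg _ _⟩

theorem eval₁_twistedOp_fun (hP : ∀ x, P x ∈ ⋀[ℝ]^2 (TangentSpace (𝓡 n) x)) (ψ : DiffForm n M 3)
    (f : C^∞⟮𝓡 n, M; ℝ⟯) (x : M) (ξ : Module.Dual ℝ (TangentSpace (𝓡 n) x)) :
    eval₁ (twistedOp P ψ (ofFun f).1 x) ξ = dFun f x (sharp P x ξ) := by
  rw [twistedOp_fun hP, ← map_neg, eval₁_ι, map_neg, apply_sharp_swap (hP x) ξ]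

theorem twistedOp_vec (hP : ∀ x, P x ∈ ⋀[ℝ]^2 (TangentSpace (𝓡 n) x)) (ψ : DiffForm n M 3)
    (X : VecField n M) (x : M) :
    twistedOp P ψ (ofVec X).1 x =
      -(∑ i, ExteriorAlgebra.ι ℝ (sharp P x (coordCovec x i)) *
        ExteriorAlgebra.ι ℝ (vecDeriv X x (coordVec x i))) - chartDeriv P x (X x)
        + sharpSq P ψ x (X x) := by
  have h : ∀ i, contr (coordCovec x i) ((ofVec X).1 x) =
      algebraMap ℝ (Fiber n x) (coordCovec x i (X x)) := fun i => contr_ι _ _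
  simp only [twistedOp, schouten_eq hP, interior, h, chartDeriv_vec, ← Algebra.commutes,
    ← Algebra.smul_def, Finset.sum_sub_distrib, Finset.sum_neg_distrib]
  rw [← chartDeriv_eq_sum, ← sharpSq_eq_sum]

theorem twistedOp_vec_mem (hPs : IsSmoothMV P) (hP : ∀ x, P x ∈ ⋀[ℝ]^2 (TangentSpace (𝓡 n) x))
    (ψ : DiffForm n M 3) (X : VecField n M) (x : M) :
    twistedOp P ψ (ofVec X).1 x ∈ ⋀[ℝ]^2 (TangentSpace (𝓡 n) x) := by
  rw [twistedOp_vec hP]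
  exact add_mem (sub_mem (neg_mem (Submodule.sum_mem _ fun _ _ => ι_mul_ι_mem _ _))
    (chartDeriv_mem hPs hP x _)) (sharpSq_mem P ψ x _)

theorem eval₂_twistedOp_vec (hP : ∀ x, P x ∈ ⋀[ℝ]^2 (TangentSpace (𝓡 n) x))
    (ψ : DiffForm n M 3) (X : VecField n M) (x : M)
    (ξ η : Module.Dual ℝ (TangentSpace (𝓡 n) x)) :
    eval₂ (twistedOp P ψ (ofVec X).1 x) ξ η =
      η (vecDeriv X x (sharp P x ξ)) - ξ (vecDeriv X x (sharp P x η))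
        - eval₂ (chartDeriv P x (X x)) ξ η
        + trilin (ψ.at x) (sharp P x ξ) (sharp P x η) (X x) := by
  -- By skew-symmetry `ζ(P^♯dxⁱ)` is minus the `i`-th component of `P^♯ζ`, so the sum over `i`
  -- assembles the derivative of `X` along `-P^♯ζ`.
  have key : ∀ ζ θ : Module.Dual ℝ (TangentSpace (𝓡 n) x),
      ∑ i, ζ (sharp P x (coordCovec x i)) * θ (vecDeriv X x (coordVec x i)) =
        -θ (vecDeriv X x (sharp P x ζ)) := by
    intro ζ θ
    rw [vecDeriv_eq_sum X x (sharp P x ζ)]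
    simp only [map_sum, map_smul, smul_eq_mul, ← Finset.sum_neg_distrib,
      apply_sharp_swap (hP x) _ ζ, neg_mul]
  rw [twistedOp_vec hP, eval₂_add, eval₂_sub, eval₂_neg, eval₂_sum, eval₂_sharpSq]
  simp only [eval₂_ι_mul_ι, Finset.sum_sub_distrib, key]
  ring

/-- The pairing of the bracket of `1`-forms with a vector, in terms of derivatives of components. -/
theorem koszul_apply (hPs : IsSmoothMV P) (hP : ∀ x, P x ∈ ⋀[ℝ]^2 (TangentSpace (𝓡 n) x))
    (ξ η : OneForm n M) (x : M) (v : TangentSpace (𝓡 n) x) :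
    koszul P ξ η x v = η.derivAlong x (sharp P x (ξ.at x)) v
      - ξ.derivAlong x (sharp P x (η.at x)) v
      + eval₂ (chartDeriv P x v) (ξ.at x) (η.at x) := by
  have e1 : (fun y => η.at y (sharp P y (ξ.at y))) = fun y => eval₂ (P y) (ξ.at y) (η.at y) :=
    funext fun y => (eval₂_eq_sharp (hP y) _ _).symm
  have e2 : (fun y => ξ.at y (sharp P y (η.at y))) = fun y => eval₂ (P y) (η.at y) (ξ.at y) :=
    funext fun y => (eval₂_eq_sharp (hP y) _ _).symm
  simp only [koszul, OneForm.lie, LinearMap.sub_apply, LinearMap.add_apply, OneForm.d_apply, e1, e2,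
    dFun_eval₂ hPs]
  -- The three differentials of `P(ξ, η)` combine, by skew-symmetry, into a single one with
  -- coefficient `+1`. Its terms in `∂_vξ` and `∂_vη` cancel the transposed halves of `dξ` and `dη`,
  -- leaving `∂_vP`.
  rw [eval₂_swap (P x) (ξ.derivAlong x v), eval₂_swap (P x) (η.derivAlong x v),
    eval₂_swap (chartDeriv P x v) (η.at x)]
  simp only [eval₂_eq_sharp (hP x)]
  ring

/-- Differentiating the pairings `η(X)` and `ξ(X)` yields derivatives of the forms, which the
bracket cancels, and derivatives of `X`, which `[P, X]` supplies. -/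
theorem eval₂_twistedOp_eq_bracket (hPs : IsSmoothMV P)
    (hP : ∀ x, P x ∈ ⋀[ℝ]^2 (TangentSpace (𝓡 n) x))
    (ψ : DiffForm n M 3) (X : VecField n M) (ξ η : OneForm n M) (x : M) :
    eval₂ (twistedOp P ψ (ofVec X).1 x) (ξ.at x) (η.at x) =
      dFun (fun y => η.at y (X y)) x (sharp P x (ξ.at x))
        - dFun (fun y => ξ.at y (X y)) x (sharp P x (η.at x))
        - bracket P ψ ξ η x (X x) := by
  rw [eval₂_twistedOp_vec hP, dFun_pairing, dFun_pairing, bracket, LinearMap.add_apply,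
    koszul_apply hPs hP, contrForm₂_eq_neg_trilin]
  ring

end Operator

/-! ### Exact forms, globalization of germs, and local generation by functions and vector fields. -/

section Extension

variable {n : ℕ} {M : Type*} [TopologicalSpace M] [ChartedSpace (Model n) M]
  [IsManifold (𝓡 n) ∞ M]

open Filter Topology

/-- The differential of a smooth function, as a `1`-form. -/
def OneForm.ofFun (f : C^∞⟮𝓡 n, M; ℝ⟯) : OneForm n M where
  toFun x := (NormedSpace.fromTangentSpace (𝕜 := ℝ) (f x)).toContinuousLinearMap ∘L
    mfderiv (𝓡 n) 𝓘(ℝ, ℝ) f x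
  contMDiff_toFun := by
    intro x
    rw [contMDiffAt_hom_bundle]
    refine ⟨contMDiffAt_id, ?_⟩
    have h := ContMDiffAt.mfderiv_const (I := 𝓡 n) (I' := 𝓘(ℝ, ℝ)) (f := f) (m := ∞) (n := ∞)
      (f.contMDiff.contMDiffAt (x := x)) le_rfl
    refine h.congr_of_eventuallyEq (Eventually.of_forall fun y => ?_)
    ext v
    simp [inTangentCoordinates, ContinuousLinearMap.inCoordinates, NormedSpace.fromTangentSpace]
    rfl

theorem OneForm.ofFun_at (f : C^∞⟮𝓡 n, M; ℝ⟯) (x : M) : (OneForm.ofFun f).at x = dFun f x :=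
  rfl

/-- Symmetry of second derivatives: `d(df) = 0`. -/
theorem OneForm.derivAlong_ofFun_comm (f : C^∞⟮𝓡 n, M; ℝ⟯) (x : M)
    (v w : TangentSpace (𝓡 n) x) :
    (OneForm.ofFun f).derivAlong x v w = (OneForm.ofFun f).derivAlong x w v := by
  set φ := extChartAt (𝓡 n) x with hφ
  set F : Model n → ℝ := f ∘ φ.symm with hF
  have hFs : ContDiffAt ℝ ∞ F (φ x) := by
    rw [← contMDiffAt_iff_contDiffAt]
    refine f.contMDiff.contMDiffAt.comp _ ?_
    exact (contMDiffOn_extChartAt_symm x).contMDiffAt (extChartAt_target_mem_nhds x)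
  have hsymm : IsSymmSndFDerivAt ℝ F (φ x) := hFs.isSymmSndFDerivAt (by
    rw [minSmoothness_of_isRCLikeNormedField]
    exact WithTop.coe_le_coe.2 (le_top : (2 : ℕ∞) ≤ ⊤))
  -- Near `x`, the components of `df` are the Fréchet derivative of the coordinate expression `F` of
  -- `f`, by the chain rule; differentiating once more gives the second derivative of `F`, which is
  -- symmetric.
  have hG : (fun y : M => (((OneForm.ofFun f) y : TangentSpace (𝓡 n) y →L[ℝ] ℝ) ∘L
      (trivializationAt (Model n) (TangentSpace (𝓡 n)) x).symmL ℝ y : Model n →L[ℝ] ℝ))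
      =ᶠ[𝓝 x] fun y => fderiv ℝ F (φ y) := by
    filter_upwards [chart_source_mem_nhds (mem_chart_source (Model n) x)] with y hy
    have hy' : y ∈ φ.source := by rwa [hφ, extChartAt_source]
    have hl : φ.symm (φ y) = y := φ.left_inv hy'
    have h1 := TangentBundle.symmL_trivializationAt (I := 𝓡 n) hy
    have hd : MDifferentiableAt 𝓘(ℝ, Model n) (𝓡 n) φ.symm (φ y) :=
      ((contMDiffOn_extChartAt_symm (n := ∞) x).contMDiffAt
        ((isOpen_extChartAt_target x).mem_nhds (φ.map_source hy'))).mdifferentiableAt (by simp)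
    have hf : MDifferentiableAt (𝓡 n) 𝓘(ℝ, ℝ) f (φ.symm (φ y)) :=
      f.contMDiff.contMDiffAt.mdifferentiableAt (by simp)
    have h2 := mfderiv_comp (φ y) hf hd
    rw [mfderiv_eq_fderiv] at h2
    have h3 : mfderiv (𝓡 n) 𝓘(ℝ, ℝ) f (φ.symm (φ y)) ∘L
        mfderiv 𝓘(ℝ, Model n) (𝓡 n) φ.symm (φ y) = fderiv ℝ F (φ y) := h2.symm
    rw [ModelWithCorners.range_eq_univ, mfderivWithin_univ] at h1
    -- The base point is generalized because the types depend on it: `φ.symm (φ y)` equals `y` only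
    -- propositionally.
    have h4 : ∀ z, z = y → ∀ u : Model n, mfderiv (𝓡 n) 𝓘(ℝ, ℝ) f y (u : TangentSpace (𝓡 n) y) =
        mfderiv (𝓡 n) 𝓘(ℝ, ℝ) f z (u : TangentSpace (𝓡 n) z) := by
      rintro _ rfl _
      rfl
    refine ContinuousLinearMap.ext fun u => ?_
    refine (congrArg (mfderiv (𝓡 n) 𝓘(ℝ, ℝ) f y) (DFunLike.congr_fun h1 u)).trans ?_
    exact (h4 _ hl _).trans (DFunLike.congr_fun h3 u)
  have hfd : DifferentiableAt ℝ (fderiv ℝ F) (φ x) :=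
    (hFs.fderiv_right (m := ∞) le_rfl).differentiableAt (by simp)
  have hφd : HasMFDerivAt (𝓡 n) 𝓘(ℝ, Model n) φ x _ :=
    ((contMDiffAt_extChartAt (n := ∞)).mdifferentiableAt (by simp)).hasMFDerivAt
  have hm := (hfd.hasFDerivAt.hasMFDerivAt.comp x hφd).congr_of_eventuallyEq hG
  have key : ∀ v w, (OneForm.ofFun f).derivAlong x v w =
      fderiv ℝ (fderiv ℝ F) (φ x) (toModel x x v) (toModel x x w) := by
    intro v w
    have h5 : (OneForm.ofFun f).chartDeriv x (toModel x x v) =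
        fderiv ℝ (fderiv ℝ F) (φ x) (mfderiv (𝓡 n) 𝓘(ℝ, Model n) φ x (toModel x x v)) :=
      DFunLike.congr_fun hm.mfderiv _
    have h6 : mfderiv (𝓡 n) 𝓘(ℝ, Model n) φ x v = toModel x x v :=
      (DFunLike.congr_fun (TangentBundle.continuousLinearMapAt_trivializationAt (I := 𝓡 n)
        (mem_chart_source (Model n) x)) v).symm
    have h7 : mfderiv (𝓡 n) 𝓘(ℝ, Model n) φ x (toModel x x v) = toModel x x v :=
      (congrArg (mfderiv (𝓡 n) 𝓘(ℝ, Model n) φ x) (toModel_self x v)).trans h6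
    change (OneForm.ofFun f).chartDeriv x (toModel x x v) (toModel x x w) = _
    rw [h5]
    exact congrArg (fun z => fderiv ℝ (fderiv ℝ F) (φ x) z (toModel x x w)) h7
  rw [key, key, hsymm]

variable [T2Space M]

theorem exists_bump {x : M} {U : Set M} (hU : U ∈ 𝓝 x) :
    ∃ χ : C^∞⟮𝓡 n, M; ℝ⟯, (∀ᶠ y in 𝓝 x, χ y = 1) ∧ tsupport χ ⊆ U := by
  obtain ⟨χ, -, hχ⟩ := (SmoothBumpFunction.nhds_basis_tsupport (I := 𝓡 n) x).mem_iff.1 hU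
  exact ⟨⟨χ, χ.contMDiff⟩, χ.eventuallyEq_one, hχ⟩

/-- A function that is smooth near a point has the germ of a global smooth function. -/
theorem exists_fun_eventuallyEq {g : M → ℝ} {U : Set M} (hU : IsOpen U)
    (hg : ContMDiffOn (𝓡 n) 𝓘(ℝ, ℝ) ∞ g U) {x : M} (hx : x ∈ U) :
    ∃ f : C^∞⟮𝓡 n, M; ℝ⟯, ∀ᶠ y in 𝓝 x, f y = g y := by
  obtain ⟨χ, h1, h2⟩ := exists_bump (n := n) (hU.mem_nhds hx)
  refine ⟨⟨fun y => χ y * g y, contMDiff_of_tsupport fun y hy => ?_⟩, ?_⟩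
  · have hy' : y ∈ U := h2 (tsupport_mul_subset_left hy)
    exact χ.contMDiff.contMDiffAt.mul (hg.contMDiffAt (hU.mem_nhds hy'))
  · filter_upwards [h1] with y hy
    change χ y * g y = g y
    rw [hy, one_mul]

/-- Global vector fields with constant components near a point. -/
theorem exists_vec_eventuallyEq {x₀ x : M} (hx : x ∈ (chartAt (Model n) x₀).source) (v : Model n) :
    ∃ X : VecField n M, ∀ᶠ y in 𝓝 x, X y = ofModel x₀ y v := by
  obtain ⟨χ, h1, h2⟩ := exists_bump (n := n) (chart_source_mem_nhds hx)
  have hs : ContMDiffOn (𝓡 n) ((𝓡 n).prod 𝓘(ℝ, Model n)) ∞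
      (fun y => Bundle.TotalSpace.mk' (Model n) y (ofModel x₀ y v : TangentSpace (𝓡 n) y))
      (chartAt (Model n) x₀).source := by
    set e := trivializationAt (Model n) (TangentSpace (𝓡 n) : M → Type) x₀ with he
    have hb : e.baseSet = (chartAt (Model n) x₀).source :=
      TangentBundle.trivializationAt_baseSet x₀
    rw [← hb, e.contMDiffOn_section_baseSet_iff]
    refine (contMDiffOn_const (c := v)).congr fun y hy => ?_
    have h3 := LinearMap.congr_fun (toModel_comp_ofModel (hb ▸ hy)) v
    have h4 := e.continuousLinearMapAt_apply_of_mem (R := ℝ) hy (ofModel x₀ y v)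
    exact h4.symm.trans h3
  refine ⟨⟨_, ContMDiffOn.smul_section_of_tsupport χ.contMDiff.contMDiffOn
    (chartAt (Model n) x₀).open_source h2 hs⟩, ?_⟩
  filter_upwards [h1] with y hy
  change χ y • ofModel x₀ y v = _
  rw [hy, one_smul]

/-- Global functions with constant differential near a point, in a chart. -/
theorem exists_fun_dFun_eventuallyEq {x₀ x : M} (hx : x ∈ (chartAt (Model n) x₀).source)
    (l : Module.Dual ℝ (Model n)) :
    ∃ f : C^∞⟮𝓡 n, M; ℝ⟯, ∀ᶠ y in 𝓝 x, dFun f y = l ∘ₗ toModel x₀ y := by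
  let L : Model n →L[ℝ] ℝ := LinearMap.toContinuousLinearMap l
  have hs : ContMDiffOn (𝓡 n) 𝓘(ℝ, ℝ) ∞ (fun y => L (extChartAt (𝓡 n) x₀ y))
      (chartAt (Model n) x₀).source :=
    L.contMDiff.comp_contMDiffOn contMDiffOn_extChartAt
  obtain ⟨f, hf⟩ := exists_fun_eventuallyEq (chartAt (Model n) x₀).open_source hs hx
  refine ⟨f, ?_⟩
  filter_upwards [hf.eventually_nhds, chart_source_mem_nhds hx] with y hy hy'
  rw [dFun_congr hy]
  have hd : MDifferentiableAt (𝓡 n) 𝓘(ℝ, Model n) (extChartAt (𝓡 n) x₀) y :=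
    mdifferentiableAt_extChartAt hy'
  have h := L.hasMFDerivAt.comp y hd.hasMFDerivAt
  rw [← TangentBundle.continuousLinearMapAt_trivializationAt hy'] at h
  exact LinearMap.ext fun v => dFun_eq_of_hasMFDerivAt h v

/-- At a given point, exact forms realize every covector, so they suffice to test multivectors
there. -/
theorem exists_fun_dFun_eq (x : M) (ξ : Module.Dual ℝ (TangentSpace (𝓡 n) x)) :
    ∃ f : C^∞⟮𝓡 n, M; ℝ⟯, dFun f x = ξ := by
  obtain ⟨f, hf⟩ := exists_fun_dFun_eventuallyEq (mem_chart_source (Model n) x) (ξ ∘ₗ ofModel x x)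
  refine ⟨f, ?_⟩
  rw [hf.self_of_nhds, LinearMap.comp_assoc, ofModel_comp_toModel (mem_chart_source (Model n) x),
    LinearMap.comp_id]

variable (n M) in
/-- The multivector fields that are polynomials in smooth functions and vector fields. -/
def polyMultiVec : Subalgebra ℝ (MultiVec n M) :=
  Algebra.adjoin ℝ (Set.range (ofFun (n := n) (M := M)) ∪ Set.range ofVec)

omit [T2Space M] in
theorem ofFun_mem (f : C^∞⟮𝓡 n, M; ℝ⟯) : ofFun f ∈ polyMultiVec n M :=
  Algebra.subset_adjoin (Or.inl ⟨f, rfl⟩)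

omit [T2Space M] in
theorem ofVec_mem (X : VecField n M) : ofVec X ∈ polyMultiVec n M :=
  Algebra.subset_adjoin (Or.inr ⟨X, rfl⟩)

/-- Constant-component multivectors are generated by constant-component vectors, whose germs extend
to global vector fields; sums and products of germs are taken globally. -/
theorem exists_poly_map_ofModel {x₀ x : M} (hx : x ∈ (chartAt (Model n) x₀).source)
    (w : ExteriorAlgebra ℝ (Model n)) :
    ∃ p ∈ polyMultiVec n M, ∀ᶠ y in 𝓝 x, p.1 y = ExteriorAlgebra.map (ofModel x₀ y) w := by
  induction w using ExteriorAlgebra.induction with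
  | algebraMap r =>
    refine ⟨algebraMap ℝ _ r, Subalgebra.algebraMap_mem _ r, Eventually.of_forall fun y => ?_⟩
    rw [AlgHom.commutes]
    rfl
  | ι v =>
    obtain ⟨X, hX⟩ := exists_vec_eventuallyEq hx v
    refine ⟨ofVec X, ofVec_mem X, hX.mono fun y hy => ?_⟩
    rw [ExteriorAlgebra.map_apply_ι, ← hy]
    rfl
  | mul a b ha hb =>
    obtain ⟨p, hp, hpa⟩ := ha
    obtain ⟨q, hq, hqb⟩ := hb
    refine ⟨p * q, mul_mem hp hq, ?_⟩
    filter_upwards [hpa, hqb] with y h1 h2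
    rw [map_mul, ← h1, ← h2]
    rfl
  | add a b ha hb =>
    obtain ⟨p, hp, hpa⟩ := ha
    obtain ⟨q, hq, hqb⟩ := hb
    refine ⟨p + q, add_mem hp hq, ?_⟩
    filter_upwards [hpa, hqb] with y h1 h2
    rw [map_add, ← h1, ← h2]
    rfl

/-- Locally, every smooth field of multivectors is a polynomial in functions and vector fields. -/
theorem exists_poly_eventuallyEq {u : ∀ x : M, Fiber n x} (hu : IsSmoothMV u) (x : M) :
    ∃ p ∈ polyMultiVec n M, ∀ᶠ y in 𝓝 x, u y = p.1 y := by
  have hx := mem_chart_source (Model n) x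
  choose f hf using fun s : Finset (Fin n) =>
    exists_fun_eventuallyEq (chartAt (Model n) x).open_source (hu x s) hx
  choose p hp hpe using fun s : Finset (Fin n) => exists_poly_map_ofModel hx (extBasis n s)
  refine ⟨∑ s, ofFun (f s) * p s, sum_mem fun s _ => mul_mem (ofFun_mem _) (hp s), ?_⟩
  filter_upwards [eventually_all.2 hf, eventually_all.2 hpe, chart_source_mem_nhds hx]
    with y h1 h2 hy
  have h3 : (∑ s, ofFun (f s) * p s).1 y =
      ∑ s, algebraMap ℝ (Fiber n y) (f s y) * (p s).1 y := by
    rw [AddSubmonoidClass.coe_finsetSum, Finset.sum_apply]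
    rfl
  rw [h3, ← map_ofModel_coords hy u, ← (extBasis n).sum_repr (coords x u y)]
  simp only [map_sum, map_smul, ← Algebra.smul_def, h1, h2]
  rfl

end Extension

/-! ### Smoothness of the twisted operator, and existence of the derivation. -/

section Smoothness

variable {n : ℕ} {M : Type*} [TopologicalSpace M] [ChartedSpace (Model n) M]
  [IsManifold (𝓡 n) ∞ M]

open Filter Topology

theorem contMDiff_pairing (ξ : OneForm n M) (X : VecField n M) :
    ContMDiff (𝓡 n) 𝓘(ℝ, ℝ) ∞ (fun y => ξ.at y (X y)) := by
  intro x
  have hx := mem_chart_source (Model n) x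
  have h := (ξ.smoothAt_coords hx).bilin (smoothAt_vec X hx) LinearMap.id
  refine (h.congr ?_).contMDiffAt
  filter_upwards [chart_source_mem_nhds hx] with y hy
  rw [ξ.at_eq_coords hy]
  rfl

theorem contMDiff_eval₂ {u : ∀ x : M, Fiber n x} (hu : IsSmoothMV u) (ξ η : OneForm n M) :
    ContMDiff (𝓡 n) 𝓘(ℝ, ℝ) ∞ (fun y => eval₂ (u y) (ξ.at y) (η.at y)) := by
  intro x
  have hx := mem_chart_source (Model n) x
  have h := ((η.smoothAt_coords hx).bilin ((ξ.smoothAt_coords hx).bilin (hu.smoothAt hx) contrₗ)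
    contrₗ).linear ExteriorAlgebra.algebraMapInv.toLinearMap
  refine (h.congr ?_).contMDiffAt
  filter_upwards [chart_source_mem_nhds hx] with y hy
  rw [eval₂_eq_coords u ξ η hy]
  rfl

theorem toModel_sharp (P : ∀ x : M, Fiber n x) (ξ : OneForm n M) {x₀ y : M}
    (hy : y ∈ (chartAt (Model n) x₀).source) :
    toModel x₀ y (sharp P y (ξ.at y)) =
      ExteriorAlgebra.ιInv (contrₗ (ξ.coords x₀ y) (coords x₀ P y)) := by
  have h := LinearMap.congr_fun (ExteriorAlgebra.ιInv_comp_map (R := ℝ) (toModel (n := n) x₀ y))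
    (contr (ξ.at y) (P y))
  rw [contrₗ_apply, ← coords_contr P ξ hy]
  exact h.symm

theorem smoothAt_sharp {P : ∀ x : M, Fiber n x} (hP : IsSmoothMV P) (ξ : OneForm n M) {x₀ y : M}
    (hy : y ∈ (chartAt (Model n) x₀).source) :
    SmoothAt n (fun z => toModel x₀ z (sharp P z (ξ.at z))) y := by
  refine (((ξ.smoothAt_coords hy).bilin (hP.smoothAt hy) contrₗ).linear
    ExteriorAlgebra.ιInv).congr ?_
  filter_upwards [chart_source_mem_nhds hy] with z hz
  exact toModel_sharp P ξ hz

/-- Continuous alternating `3`-forms as trilinear maps. -/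
def contTrilin (n : ℕ) :
    (Model n [⋀^Fin 3]→L[ℝ] ℝ) →ₗ[ℝ] Model n →ₗ[ℝ] Model n →ₗ[ℝ] Model n →ₗ[ℝ] ℝ :=
  trilin ∘ₗ ContinuousAlternatingMap.toAlternatingMapLinear

theorem contTrilin_apply (ψ : Model n [⋀^Fin 3]→L[ℝ] ℝ) (a b c : Model n) :
    contTrilin n ψ a b c = ψ ![a, b, c] :=
  trilin_apply _ a b c

/-- Yields finite-dimensionality of the space of `3`-forms, which is what allows smoothness of `ψ`
to be tested on linear functionals. -/
theorem contTrilin_injective : Function.Injective (contTrilin n) := by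
  intro ψ φ h
  ext v
  have h2 : ![v 0, v 1, v 2] = v := by
    ext i
    fin_cases i <;> rfl
  have h3 := contTrilin_apply ψ (v 0) (v 1) (v 2)
  rw [h, contTrilin_apply, h2] at h3
  exact h3.symm

set_option maxSynthPendingDepth 5 in
instance : FiniteDimensional ℝ (Model n [⋀^Fin 3]→L[ℝ] ℝ) :=
  Module.Finite.of_injective (contTrilin n) contTrilin_injective

set_option maxSynthPendingDepth 5 in
theorem contMDiff_trilin_sharp {P : ∀ x : M, Fiber n x} (hP : IsSmoothMV P) (ψ : DiffForm n M 3)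
    (ξ η : OneForm n M) (X : VecField n M) :
    ContMDiff (𝓡 n) 𝓘(ℝ, ℝ) ∞
      (fun y => trilin (ψ.at y) (sharp P y (ξ.at y)) (sharp P y (η.at y)) (X y)) := by
  intro x
  have hx := mem_chart_source (Model n) x
  have hψ := (smoothAt_of_contMDiffAt
    ((ψ.smooth x).contMDiffAt (chart_source_mem_nhds hx))).linear (contTrilin n)
  have h := ((hψ.bilin (smoothAt_sharp hP ξ hx) LinearMap.id).bilin (smoothAt_sharp hP η hx)
    LinearMap.id).bilin (smoothAt_vec X hx) LinearMap.id
  refine (h.congr ?_).contMDiffAt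
  filter_upwards [chart_source_mem_nhds hx] with y hy
  have e : ∀ v : TangentSpace (𝓡 n) y, ofModel x y (toModel x y v) = v :=
    LinearMap.congr_fun (ofModel_comp_toModel hy)
  simp only [LinearMap.id_apply]
  rw [contTrilin_apply, trilin_apply]
  conv_lhs => rw [← e (sharp P y (ξ.at y)), ← e (sharp P y (η.at y)), ← e (X y)]
  change ψ.toFun y _ = ψ.toFun y _
  congr 1
  ext i
  fin_cases i <;> rfl

/-- The smooth function `Xf`. -/
def VecField.deriv (X : VecField n M) (f : C^∞⟮𝓡 n, M; ℝ⟯) : C^∞⟮𝓡 n, M; ℝ⟯ :=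
  ⟨fun x => dFun f x (X x), contMDiff_pairing (OneForm.ofFun f) X⟩

variable [T2Space M]

/-- There are global functions whose differentials are the coordinate covectors of a chart on a
whole neighbourhood of a point; the values of `w` on these are its components there. -/
theorem isSmoothMV_of_eval₁ {w : ∀ x : M, Fiber n x}
    (hw : ∀ x, w x ∈ ⋀[ℝ]^1 (TangentSpace (𝓡 n) x))
    (h : ∀ g : C^∞⟮𝓡 n, M; ℝ⟯, ContMDiff (𝓡 n) 𝓘(ℝ, ℝ) ∞ (fun x => eval₁ (w x) (dFun g x))) :
    IsSmoothMV w := by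
  refine isSmoothMV_of_smoothAt fun x₀ y hy => ?_
  let b := (EuclideanSpace.basisFun (Fin n) ℝ).toBasis
  choose g hg using fun i => exists_fun_dFun_eventuallyEq hy (b.coord i)
  have hs : SmoothAt n (fun z => ∑ i, eval₁ (w z) (dFun (g i) z) • ExteriorAlgebra.ι ℝ (b i)) y :=
    SmoothAt.sum _ fun i _ => (smoothAt_of_contMDiffAt (h (g i)).contMDiffAt).linear
      (LinearMap.toSpanSingleton ℝ _ (ExteriorAlgebra.ι ℝ (b i)))
  refine hs.congr ?_
  filter_upwards [eventually_all.2 hg] with z hz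
  have hz2 : coords x₀ w z ∈ ⋀[ℝ]^1 (Model n) := map_mem_exteriorPower (toModel x₀ z) 1 (hw z)
  rw [eq_sum_eval₁ b hz2]
  simp only [coords, eval₁_map, hz]

theorem isSmoothMV_of_eval₂ {w : ∀ x : M, Fiber n x}
    (hw : ∀ x, w x ∈ ⋀[ℝ]^2 (TangentSpace (𝓡 n) x))
    (h : ∀ f g : C^∞⟮𝓡 n, M; ℝ⟯,
      ContMDiff (𝓡 n) 𝓘(ℝ, ℝ) ∞ (fun x => eval₂ (w x) (dFun f x) (dFun g x))) :
    IsSmoothMV w := by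
  refine isSmoothMV_of_smoothAt fun x₀ y hy => ?_
  let b := (EuclideanSpace.basisFun (Fin n) ℝ).toBasis
  choose g hg using fun i => exists_fun_dFun_eventuallyEq hy (b.coord i)
  have hs : SmoothAt n (fun z => ∑ i, ∑ j, eval₂ (w z) (dFun (g i) z) (dFun (g j) z) •
      (ExteriorAlgebra.ι ℝ (b i) * ExteriorAlgebra.ι ℝ (b j))) y :=
    SmoothAt.sum _ fun i _ => SmoothAt.sum _ fun j _ =>
      (smoothAt_of_contMDiffAt (h (g i) (g j)).contMDiffAt).linear (LinearMap.toSpanSingleton ℝ _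
        (ExteriorAlgebra.ι ℝ (b i) * ExteriorAlgebra.ι ℝ (b j)))
  refine (hs.linear ((2 : ℝ)⁻¹ • LinearMap.id)).congr ?_
  filter_upwards [eventually_all.2 hg] with z hz
  have hz2 : coords x₀ w z ∈ ⋀[ℝ]^2 (Model n) := map_mem_exteriorPower (toModel x₀ z) 2 (hw z)
  rw [eq_sum_eval₂ b hz2]
  simp only [coords, eval₂_map, hz, LinearMap.smul_apply, LinearMap.id_apply]

variable {P : ∀ x : M, Fiber n x}

theorem isSmoothMV_twistedOp_fun (hPs : IsSmoothMV P)
    (hP : ∀ x, P x ∈ ⋀[ℝ]^2 (TangentSpace (𝓡 n) x)) (ψ : DiffForm n M 3)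
    (f : C^∞⟮𝓡 n, M; ℝ⟯) : IsSmoothMV (twistedOp P ψ (ofFun f).1) := by
  refine isSmoothMV_of_eval₁ (twistedOp_fun_mem hP ψ f) fun g => ?_
  simp only [eval₁_twistedOp_fun hP, ← eval₂_eq_sharp (hP _)]
  exact contMDiff_eval₂ hPs (OneForm.ofFun g) (OneForm.ofFun f)

omit [T2Space M] in
/-- For exact `1`-forms, the bracket `[df, dg]^P` is `d(P(df, dg))`. -/
theorem koszul_ofFun (hPs : IsSmoothMV P) (hP : ∀ x, P x ∈ ⋀[ℝ]^2 (TangentSpace (𝓡 n) x))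
    (f g : C^∞⟮𝓡 n, M; ℝ⟯) (x : M) (v : TangentSpace (𝓡 n) x) :
    koszul P (OneForm.ofFun f) (OneForm.ofFun g) x v =
      dFun (fun y => eval₂ (P y) (dFun f y) (dFun g y)) x v := by
  have h := dFun_eval₂ hPs (OneForm.ofFun f) (OneForm.ofFun g) x v
  simp only [OneForm.ofFun_at] at h
  rw [koszul_apply hPs hP, h, OneForm.derivAlong_ofFun_comm g, OneForm.derivAlong_ofFun_comm f,
    eval₂_swap (P x) (OneForm.derivAlong _ x v)]
  simp only [eval₂_eq_sharp (hP x), OneForm.ofFun_at]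
  ring

/-- On exact forms the value of the operator is `P(df, d(Xg)) - P(dg, d(Xf)) - X(P(df, dg)) +
ψ(P^♯df, P^♯dg, X)`. No chart appears in it, and every term is visibly smooth. -/
theorem isSmoothMV_twistedOp_vec (hPs : IsSmoothMV P)
    (hP : ∀ x, P x ∈ ⋀[ℝ]^2 (TangentSpace (𝓡 n) x)) (ψ : DiffForm n M 3) (X : VecField n M) :
    IsSmoothMV (twistedOp P ψ (ofVec X).1) := by
  refine isSmoothMV_of_eval₂ (twistedOp_vec_mem hPs hP ψ X) fun f g => ?_
  have e : (fun x => eval₂ (twistedOp P ψ (ofVec X).1 x) (dFun f x) (dFun g x)) = fun x =>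
      eval₂ (P x) (dFun f x) (dFun (X.deriv g) x) - eval₂ (P x) (dFun g x) (dFun (X.deriv f) x)
        - dFun (fun y => eval₂ (P y) (dFun f y) (dFun g y)) x (X x)
        + trilin (ψ.at x) (sharp P x (dFun f x)) (sharp P x (dFun g x)) (X x) := by
    funext x
    have h := eval₂_twistedOp_eq_bracket hPs hP ψ X (OneForm.ofFun f) (OneForm.ofFun g) x
    rw [bracket, LinearMap.add_apply, koszul_ofFun hPs hP, contrForm₂_eq_neg_trilin] at h
    simp only [OneForm.ofFun_at] at h
    rw [h, eval₂_eq_sharp (hP x), eval₂_eq_sharp (hP x)]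
    change dFun (X.deriv g) x _ - dFun (X.deriv f) x _ - _ = _
    ring
  rw [e]
  have h2 := contMDiff_eval₂ hPs (OneForm.ofFun f) (OneForm.ofFun g)
  have h3 := contMDiff_pairing (OneForm.ofFun ⟨_, h2⟩) X
  exact (((contMDiff_eval₂ hPs (OneForm.ofFun f) (OneForm.ofFun (X.deriv g))).sub
    (contMDiff_eval₂ hPs (OneForm.ofFun g) (OneForm.ofFun (X.deriv f)))).sub h3).add
    (contMDiff_trilin_sharp hPs ψ (OneForm.ofFun f) (OneForm.ofFun g) X)

omit [T2Space M] in
theorem isSmoothMV_involute {u : ∀ x : M, Fiber n x} (hu : IsSmoothMV u) :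
    IsSmoothMV (fun x => CliffordAlgebra.involute (u x)) :=
  isSmoothMV_of_smoothAt fun _ _ hy =>
    ((hu.smoothAt hy).linear CliffordAlgebra.involute.toLinearMap).congr
      (Eventually.of_forall fun _ => map_involute _ _)

/-- Smoothness passes from functions and vector fields to the polynomials in them by the Leibniz
rule, and then to all multivector fields because both smoothness and the operator are local. -/
theorem isSmoothMV_twistedOp (hPs : IsSmoothMV P)
    (hP : ∀ x, P x ∈ ⋀[ℝ]^2 (TangentSpace (𝓡 n) x)) (ψ : DiffForm n M 3)
    {u : ∀ x : M, Fiber n x} (hu : IsSmoothMV u) : IsSmoothMV (twistedOp P ψ u) := by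
  have hpoly : ∀ p ∈ polyMultiVec n M, IsSmoothMV (twistedOp P ψ p.1) := by
    intro p hp
    induction hp using Algebra.adjoin_induction with
    | mem p hp =>
      rcases hp with ⟨f, rfl⟩ | ⟨X, rfl⟩
      · exact isSmoothMV_twistedOp_fun hPs hP ψ f
      · exact isSmoothMV_twistedOp_vec hPs hP ψ X
    | algebraMap r => exact isSmoothMV_twistedOp_fun hPs hP ψ ⟨fun _ => r, contMDiff_const⟩
    | add p q _ _ h1 h2 =>
      have e : twistedOp P ψ (p + q).1 = twistedOp P ψ p.1 + twistedOp P ψ q.1 :=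
        funext fun x => twistedOp_add ψ p.2 q.2 x
      rw [e]
      exact (MultiVec n M).add_mem h1 h2
    | mul p q _ _ h1 h2 =>
      have e : twistedOp P ψ (p * q).1 = twistedOp P ψ p.1 * q.1 +
          (fun x => CliffordAlgebra.involute (p.1 x)) * twistedOp P ψ q.1 :=
        funext fun x => twistedOp_mul hPs hP ψ p.2 q.2 x
      rw [e]
      exact (MultiVec n M).add_mem ((MultiVec n M).mul_mem h1 q.2)
        ((MultiVec n M).mul_mem (isSmoothMV_involute p.2) h2)
  refine isSmoothMV_of_locally fun y => ?_
  obtain ⟨p, hp, he⟩ := exists_poly_eventuallyEq hu y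
  -- The operator differentiates, so `u` and `p` must agree on a neighbourhood of each nearby `z`,
  -- not only at `z`.
  exact ⟨_, hpoly p hp, he.eventually_nhds.mono fun z hz => twistedOp_congr P ψ hz⟩

/-- The derivation `[P, ·]_{SN} + i_{(⋀²P^♯)(ψ)}` of the algebra of multivector fields. -/
def twistedDer (P : MultiVec n M) (hP : ∀ x, P.1 x ∈ ⋀[ℝ]^2 (TangentSpace (𝓡 n) x))
    (ψ : DiffForm n M 3) : MultiVec n M →ₗ[ℝ] MultiVec n M where
  toFun u := ⟨twistedOp P.1 ψ u.1, isSmoothMV_twistedOp P.2 hP ψ u.2⟩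
  map_add' u v := Subtype.ext (funext fun x => twistedOp_add ψ u.2 v.2 x)
  map_smul' r u := Subtype.ext (funext fun x => twistedOp_smul ψ r u.2 x)

theorem isAssociatedDerivation_twistedDer (P : MultiVec n M)
    (hP : ∀ x, P.1 x ∈ ⋀[ℝ]^2 (TangentSpace (𝓡 n) x)) (ψ : DiffForm n M 3) :
    IsAssociatedDerivation P.1 ψ (twistedDer P hP ψ) where
  leibniz u v x := twistedOp_mul P.2 hP ψ u.2 v.2 x
  degree_fun f x := twistedOp_fun_mem hP ψ f x
  eval_fun f ξ x := eval₁_twistedOp_fun hP ψ f x (ξ.at x)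
  degree_vec X x := twistedOp_vec_mem P.2 hP ψ X x
  eval_vec X ξ η x := eval₂_twistedOp_eq_bracket P.2 hP ψ X ξ η x

/-! ### Uniqueness. -/

variable {ψ : DiffForm n M 3} {D D' : MultiVec n M →ₗ[ℝ] MultiVec n M}

/-- A derivation associated with a bracket is a local operator. -/
theorem IsAssociatedDerivation.congr (hD : IsAssociatedDerivation P ψ D) {u v : MultiVec n M}
    {x : M} (h : ∀ᶠ y in 𝓝 x, u.1 y = v.1 y) : (D u).1 x = (D v).1 x := by
  -- The bump function is supported where `u - v` vanishes, so `χ(u - v) = 0`. The Leibniz rule at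
  -- `x`, where `χ = 1` and `u - v = 0`, then leaves `D(u - v) = 0`.
  obtain ⟨χ, h1, h2⟩ := exists_bump (n := n) (U := {y | (u - v).1 y = 0})
    (h.mono fun y hy => sub_eq_zero.2 hy)
  have h0 : ofFun χ * (u - v) = 0 := by
    refine Subtype.ext (funext fun y => ?_)
    change algebraMap ℝ (Fiber n y) (χ y) * (u - v).1 y = 0
    by_cases hy : χ y = 0
    · rw [hy, map_zero, zero_mul]
    · have h3 : (u - v).1 y = 0 := h2 (subset_tsupport _ hy)
      rw [h3, mul_zero]
  have h3 := hD.leibniz (ofFun χ) (u - v) x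
  have h4 : (u - v).1 x = 0 := sub_eq_zero.2 h.self_of_nhds
  have h5 : (ofFun χ).1 x = 1 := by
    change algebraMap ℝ (Fiber n x) (χ x) = 1
    rw [h1.self_of_nhds, map_one]
  rw [h0, map_zero, h4, mul_zero, zero_add, h5, map_one, one_mul, map_sub] at h3
  exact (sub_eq_zero.1 h3.symm)

/-- The prescribed degrees and values on exact forms fix `D` on functions and vector fields, the
Leibniz rule fixes it on polynomials in these, and locality on everything. -/
theorem IsAssociatedDerivation.unique (hD : IsAssociatedDerivation P ψ D)
    (hD' : IsAssociatedDerivation P ψ D') : D = D' := by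
  have hfun : ∀ f, D (ofFun f) = D' (ofFun f) := fun f => by
    refine Subtype.ext (funext fun x => ?_)
    refine ext_of_mem_one (tangentBasis x) (hD.degree_fun f x) (hD'.degree_fun f x) fun ξ => ?_
    obtain ⟨g, rfl⟩ := exists_fun_dFun_eq x ξ
    exact (hD.eval_fun f (OneForm.ofFun g) x).trans (hD'.eval_fun f (OneForm.ofFun g) x).symm
  have hvec : ∀ X, D (ofVec X) = D' (ofVec X) := fun X => by
    refine Subtype.ext (funext fun x => ?_)
    refine ext_of_mem_two (tangentBasis x) (hD.degree_vec X x) (hD'.degree_vec X x) fun ξ η => ?_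
    obtain ⟨f, rfl⟩ := exists_fun_dFun_eq x ξ
    obtain ⟨g, rfl⟩ := exists_fun_dFun_eq x η
    exact (hD.eval_vec X (OneForm.ofFun f) (OneForm.ofFun g) x).trans
      (hD'.eval_vec X (OneForm.ofFun f) (OneForm.ofFun g) x).symm
  have hpoly : ∀ p ∈ polyMultiVec n M, D p = D' p := by
    intro p hp
    induction hp using Algebra.adjoin_induction with
    | mem p hp =>
      rcases hp with ⟨f, rfl⟩ | ⟨X, rfl⟩
      · exact hfun f
      · exact hvec X
    | algebraMap r => exact hfun ⟨fun _ => r, contMDiff_const⟩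
    | add p q _ _ h1 h2 => rw [map_add, map_add, h1, h2]
    | mul p q _ _ h1 h2 =>
      refine Subtype.ext (funext fun x => ?_)
      rw [hD.leibniz, hD'.leibniz, h1, h2]
  refine LinearMap.ext fun u => Subtype.ext (funext fun x => ?_)
  obtain ⟨p, hp, he⟩ := exists_poly_eventuallyEq u.2 x
  rw [hD.congr he, hD'.congr he, hpoly p hp]

end Smoothness

end PoissonBackground

end

theorem mainTheorem6 (n : ℕ) (M : Type*) [TopologicalSpace M] [T2Space M]
    [ChartedSpace (PoissonBackground.Model n) M] [IsManifold (𝓡 n) ∞ M]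
    (P : PoissonBackground.MultiVec n M)
    (hP : ∀ x : M, P.1 x ∈ ⋀[ℝ]^2 (TangentSpace (𝓡 n) x))
    (ψ : PoissonBackground.DiffForm n M 3) :
    (∃! D : PoissonBackground.MultiVec n M →ₗ[ℝ] PoissonBackground.MultiVec n M,
        PoissonBackground.IsAssociatedDerivation P.1 ψ D) ∧
      ∀ D : PoissonBackground.MultiVec n M →ₗ[ℝ] PoissonBackground.MultiVec n M,
        PoissonBackground.IsAssociatedDerivation P.1 ψ D →
          ∀ (u : PoissonBackground.MultiVec n M) (x : M),
            (D u).1 x = PoissonBackground.schouten P.1 u.1 x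
              + PoissonBackground.interior (PoissonBackground.sharpSq P.1 ψ) u.1 x := by
  have h := PoissonBackground.isAssociatedDerivation_twistedDer P hP ψ
  refine ⟨⟨_, h, fun D hD => hD.unique h⟩, fun D hD u x => ?_⟩
  rw [hD.unique h]
  rfl
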